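/- Let $d \ge 1$, let $p \in [1,\infty]$ and let $s \in \mathbb{R}$ with $s \ge d/p$ (where $d/\infty = 0$). All function spaces are on $\mathbb{R}^d$ and complex valued, with the Fourier transform $\widehat f(\xi) = \int e^{-2\pi i x\cdot\xi} f(x)\,dx$ (extended to tempered distributions). Fix a smooth radial function $\chi : \mathbb{R}^d \to \mathbb{R}$, supported in the ball of radius $2$, equal to $1$ in a neighborhood of the closed unit ball, and such that $r \mapsto \chi(re)$ is nonincreasing on $[0,\infty)$ for every unit vector $e$. Put $\varphi(\xi) = \chi(\xi) - \chi(2\xi)$ and let $\dot\Delta_m$, $m \in \mathbb{Z}$, be the Fourier multiplier with symbol $\varphi(2^{-m}\xi)$. The homogeneous Besov space $\dot B^s_{p,\infty}$ is the space of classes $f$ of tempered distributions modulo polynomials with $$\|f\|_{\dot B^s_{p,\infty}} = \sup_{m \in \mathbb{Z}} 2^{ms} \|\dot\Delta_m f\|_{L^p} < \infty .$$ Let $\mathcal{S}'_h$ be the space of tempered distributions $f$ with $\chi(\lambda\xi)\widehat f(\xi) \to 0$ in $\mathcal{S}'$ as $\lambda \to +\infty$, and let $C^s_p$ be the closure in $\dot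 B^s_{p,\infty}$ of $\mathcal{S}'_h \cap \dot B^s_{p,\infty}$, the set of classes in $\dot B^s_{p,\infty}$ that have a representative in $\mathcal{S}'_h$. Let $\ell^\infty$ be the space of bounded complex sequences $(u(n))_{n \ge 0}$, and $c_0$ its subspace of sequences tending to zero. Quotients carry the quotient norm. Then the quotient space $\dot B^s_{p,\infty}/C^s_p$ is not separable. In fact, $\ell^\infty/c_0$ is not separable, and there exist a nonzero Schwartz function $\psi$ with $\widehat\psi \ge 0$ and $\varphi\widehat\psi = \widehat\psi$, and a bounded linear map $J : \ell^\infty \to \dot B^s_{p,\infty}$, such that: 1. $Ju$ is formed by the dyadic low-frequency bumps $\psi(2^{-n}x)$, $n \ge 0$: for all $u \in \ell^\infty$, one has $\dot\Delta_{-n} Ju(x) = u(n)\, 2^{n(s - d/p)}\, \psi(2^{-n}x)$ for all $n \ge 0$, and $\dot\Delta_m Ju = 0$ for all $m > 0$; 2. $J$ is an embedding: there are constants $a, b > 0$ with $a\|u\|_{\ell^\infty} \le \|Ju\|_{\dot B^s_{p,\infty}} \le b\|u\|_{\ell^\infty}$ for all $u \in \ell^\infty$; 3. $J(c_0) \subset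 C^s_p$, and the induced linear map $J' : \ell^\infty/c_0 \to \dot B^s_{p,\infty}/C^s_p$ is a quasi-isometric embedding: there are constants $a, b > 0$ with $a\|v\|_{\ell^\infty/c_0} \le \|J'v\|_{\dot B^s_{p,\infty}/C^s_p} \le b\|v\|_{\ell^\infty/c_0}$ for all $v \in \ell^\infty/c_0$. -/

import Mathlib

open MeasureTheory Filter Topology
open scoped SchwartzMap FourierTransform ENNReal LineDeriv

noncomputable section

/-- A low-frequency cut-off `χ` on `ℝ^d` used to build the Littlewood-Paley decomposition: smooth,
radial, supported in the ball of radius `2`, equal to `1` near the unit ball, and radially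
nonincreasing. -/
structure LPCutoff (d : ℕ) where
  toFun : EuclideanSpace ℝ (Fin d) → ℝ
  smooth : ContDiff ℝ (⊤ : ℕ∞) toFun
  radial : ∀ ξ η, ‖ξ‖ = ‖η‖ → toFun ξ = toFun η
  support_subset : tsupport toFun ⊆ Metric.closedBall 0 2
  eq_one : ∀ᶠ ξ in 𝓝ˢ (Metric.closedBall 0 1), toFun ξ = 1
  antitone : ∀ e, ‖e‖ = 1 → AntitoneOn (fun r : ℝ => toFun (r • e)) (Set.Ici 0)

namespace LPCutoff

variable {d : ℕ} (χ : LPCutoff d)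

/-- `φ(ξ) = χ(ξ) - χ(2ξ)`. -/
def annulus (ξ : EuclideanSpace ℝ (Fin d)) : ℝ := χ.toFun ξ - χ.toFun ((2 : ℝ) • ξ)

/-- `φ_m(ξ) = φ(2^{-m} ξ)`, as a complex valued symbol. -/
def dyadicSymbol (m : ℤ) (ξ : EuclideanSpace ℝ (Fin d)) : ℂ :=
  (χ.annulus ((2 : ℝ) ^ (-m) • ξ) : ℂ)

/-- `ξ ↦ χ(lam ξ)`, as a complex valued symbol. -/
def lowSymbol (lam : ℝ) (ξ : EuclideanSpace ℝ (Fin d)) : ℂ := (χ.toFun (lam • ξ) : ℂ)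

/-- The homogeneous dyadic block `Δ_m = φ(2^{-m} D)` acting on tempered distributions. -/
def block (m : ℤ) :
    𝓢'(EuclideanSpace ℝ (Fin d), ℂ) →L[ℂ] 𝓢'(EuclideanSpace ℝ (Fin d), ℂ) :=
  TemperedDistribution.fourierMultiplierCLM ℂ (χ.dyadicSymbol m)

/-- The space `S'_h`: tempered distributions `f` with `χ(lam ξ) f^(ξ) → 0` in `S'` as
`lam → +∞`. -/
def homDistributions : Submodule ℂ 𝓢'(EuclideanSpace ℝ (Fin d), ℂ) where
  carrier := {f | Tendsto (fun lam : ℝ =>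
    TemperedDistribution.smulLeftCLM ℂ (χ.lowSymbol lam) (𝓕 f)) atTop (𝓝 0)}
  zero_mem' := by
    have h : 𝓕 (0 : 𝓢'(EuclideanSpace ℝ (Fin d), ℂ)) = 0 := by ext g; simp
    simp only [Set.mem_ofPred_eq, h, map_zero]
    exact tendsto_const_nhds
  add_mem' := by
    intro f g hf hg
    simp only [Set.mem_ofPred_eq, FourierTransform.fourier_add, map_add] at hf hg ⊢
    simpa using hf.add hg
  smul_mem' := by
    intro c f hf
    simp only [Set.mem_ofPred_eq, FourierTransform.fourier_smul, map_smul] at hf ⊢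
    rw [← smul_zero c]
    exact hf.const_smul c

end LPCutoff

/-! ### Tempered distributions modulo polynomials -/

theorem polyFun_hasTemperateGrowth {d : ℕ} (P : MvPolynomial (Fin d) ℂ) :
    Function.HasTemperateGrowth (fun x : EuclideanSpace ℝ (Fin d) =>
      MvPolynomial.eval (fun i => (x i : ℂ)) P) := by
  induction P using MvPolynomial.induction_on with
  | C a => simp [Function.HasTemperateGrowth.const]
  | add p q hp hq =>
    have h := hp.add hq
    simp only [map_add]
    exact h
  | mul_X p i hp =>
    have h1 : Function.HasTemperateGrowth (fun x : EuclideanSpace ℝ (Fin d) => x i) :=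
      (EuclideanSpace.proj (𝕜 := ℝ) i).hasTemperateGrowth
    have h2 : Function.HasTemperateGrowth (fun x : EuclideanSpace ℝ (Fin d) => (x i : ℂ)) := by
      fun_prop
    have h := hp.mul h2
    simp only [map_mul, MvPolynomial.eval_X]
    exact h

/-- The tempered distribution `g ↦ ∫ g(x) P(x) dx` of a polynomial `P` in `d` variables. -/
def polyDistribution (d : ℕ) :
    MvPolynomial (Fin d) ℂ →ₗ[ℂ] 𝓢'(EuclideanSpace ℝ (Fin d), ℂ) where
  toFun P := (polyFun_hasTemperateGrowth P).toTemperedDistribution volume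
  map_add' P Q := by
    ext g
    have hi : ∀ R : MvPolynomial (Fin d) ℂ, Integrable (fun x : EuclideanSpace ℝ (Fin d) =>
        g x • MvPolynomial.eval (fun i => (x i : ℂ)) R) := fun R =>
      (SchwartzMap.bilinLeftCLM (ContinuousLinearMap.lsmul ℂ ℂ)
        (polyFun_hasTemperateGrowth R) g).integrable
    change (polyFun_hasTemperateGrowth (P + Q)).toTemperedDistribution volume g =
      (polyFun_hasTemperateGrowth P).toTemperedDistribution volume g +
      (polyFun_hasTemperateGrowth Q).toTemperedDistribution volume g
    simp only [Function.HasTemperateGrowth.toTemperedDistribution_apply]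
    rw [← integral_add (hi P) (hi Q)]
    simp only [map_add, smul_add]
  map_smul' c P := by
    ext g
    change (polyFun_hasTemperateGrowth (c • P)).toTemperedDistribution volume g =
      c • (polyFun_hasTemperateGrowth P).toTemperedDistribution volume g
    simp only [Function.HasTemperateGrowth.toTemperedDistribution_apply]
    rw [← integral_smul]
    congr 1
    ext x
    simp [mul_left_comm]

theorem polyDistribution_apply {d : ℕ} (P : MvPolynomial (Fin d) ℂ)
    (g : 𝓢(EuclideanSpace ℝ (Fin d), ℂ)) :
    polyDistribution d P g = ∫ x, g x * MvPolynomial.eval (fun i => (x i : ℂ)) P := rfl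

/-- The subspace of tempered distributions given by polynomials. Distributions are complex valued,
so the polynomials have complex coefficients. -/
def polySubmodule (d : ℕ) : Submodule ℂ 𝓢'(EuclideanSpace ℝ (Fin d), ℂ) :=
  LinearMap.range (polyDistribution d)

/-- The Fourier transform of a polynomial vanishes away from the origin. -/
theorem polyDistribution_fourier_eq_zero {d : ℕ} (P : MvPolynomial (Fin d) ℂ) :
    ∀ h : 𝓢(EuclideanSpace ℝ (Fin d), ℂ), (0 : EuclideanSpace ℝ (Fin d)) ∉ tsupport h →
      polyDistribution d P (𝓕 h) = 0 := by
  induction P using MvPolynomial.induction_on with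
  | C a =>
    intro h hh
    have h0 : h 0 = 0 := image_eq_zero_of_notMem_tsupport hh
    have h1 : 𝓕⁻ (𝓕 h) (0 : EuclideanSpace ℝ (Fin d)) = ∫ x, 𝓕 h x := by
      rw [SchwartzMap.fourierInv_coe, Real.fourierInv_eq]
      simp
    rw [FourierTransform.fourierInv_fourier_eq, h0] at h1
    rw [polyDistribution_apply]
    simp only [MvPolynomial.eval_C]
    rw [integral_mul_const, ← h1, zero_mul]
  | add p q hp hq =>
    intro h hh
    rw [map_add]
    change polyDistribution d p (𝓕 h) + polyDistribution d q (𝓕 h) = 0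
    rw [hp h hh, hq h hh, add_zero]
  | mul_X p i hp =>
    intro h hh
    set e : EuclideanSpace ℝ (Fin d) := EuclideanSpace.single i 1 with he
    have hs : (0 : EuclideanSpace ℝ (Fin d)) ∉ tsupport (∂_{e} h : 𝓢(_, ℂ)) := by
      intro hmem
      exact hh (SchwartzMap.tsupport_lineDerivOp_subset e h hmem)
    have h1 := hp _ hs
    rw [SchwartzMap.fourier_lineDerivOp_eq, map_smul, smul_eq_mul] at h1
    have hc : (2 * Real.pi * Complex.I : ℂ) ≠ 0 := Complex.two_pi_I_ne_zero
    have h2 := (mul_eq_zero.mp h1).resolve_left hc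
    rw [polyDistribution_apply] at h2 ⊢
    rw [← h2]
    congr 1
    ext x
    have hg : (fun x : EuclideanSpace ℝ (Fin d) => inner ℝ x e).HasTemperateGrowth := by fun_prop
    rw [SchwartzMap.smulLeftCLM_apply_apply hg]
    simp [he, EuclideanSpace.inner_single_right]
    ring

namespace LPCutoff

variable {d : ℕ} (χ : LPCutoff d)

theorem zero_notMem_tsupport_dyadicSymbol (m : ℤ) :
    (0 : EuclideanSpace ℝ (Fin d)) ∉ tsupport (χ.dyadicSymbol m) := by
  rw [notMem_tsupport_iff_eventuallyEq]
  have h1 : ∀ᶠ ξ in 𝓝 (0 : EuclideanSpace ℝ (Fin d)), χ.toFun ξ = 1 :=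
    χ.eq_one.filter_mono (nhds_le_nhdsSet (by simp))
  have hc : ∀ c : ℝ, Tendsto (fun ξ : EuclideanSpace ℝ (Fin d) => c • ξ) (𝓝 0) (𝓝 0) := by
    intro c
    have : Continuous (fun ξ : EuclideanSpace ℝ (Fin d) => c • ξ) := by fun_prop
    simpa using this.tendsto 0
  filter_upwards [(hc ((2 : ℝ) ^ (-m))).eventually h1,
    ((hc 2).comp (hc ((2 : ℝ) ^ (-m)))).eventually h1] with ξ h2 h3
  simp only [Function.comp_apply] at h3
  rw [dyadicSymbol, annulus, h2, h3]
  simp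

theorem polySubmodule_le_ker_block (m : ℤ) :
    polySubmodule d ≤ LinearMap.ker (χ.block m).toLinearMap := by
  rintro _ ⟨P, rfl⟩
  rw [LinearMap.mem_ker]
  ext g
  change polyDistribution d P
    (𝓕 (SchwartzMap.smulLeftCLM ℂ (χ.dyadicSymbol m) (𝓕⁻ g))) = 0
  apply polyDistribution_fourier_eq_zero
  intro hmem
  exact χ.zero_notMem_tsupport_dyadicSymbol m
    (SchwartzMap.tsupport_smulLeftCLM_subset _ _ hmem).2

/-- The dyadic block `Δ_m` on tempered distributions modulo polynomials: it kills polynomials, so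
`Δ_m f` is a well-defined tempered distribution. -/
def blockMod (m : ℤ) :
    (𝓢'(EuclideanSpace ℝ (Fin d), ℂ) ⧸ polySubmodule d) →ₗ[ℂ]
      𝓢'(EuclideanSpace ℝ (Fin d), ℂ) :=
  (polySubmodule d).liftQ (χ.block m).toLinearMap (χ.polySubmodule_le_ker_block m)

end LPCutoff

/-! ### Homogeneous Besov spaces -/

/-- The `L^p` norm of a tempered distribution, with value `∞` if it is not given by an `L^p`
function. (There is at most one `g` below.) -/
def lpENorm {d : ℕ} (p : ℝ≥0∞) [Fact (1 ≤ p)] (T : 𝓢'(EuclideanSpace ℝ (Fin d), ℂ)) : ℝ≥0∞ :=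
  ⨅ (g : Lp ℂ p (volume : Measure (EuclideanSpace ℝ (Fin d))))
    (_ : Lp.toTemperedDistribution g = T), ‖g‖ₑ

section lpENorm

variable {d : ℕ} (p : ℝ≥0∞) [Fact (1 ≤ p)]

theorem lpENorm_zero : lpENorm p (0 : 𝓢'(EuclideanSpace ℝ (Fin d), ℂ)) = 0 := by
  refine le_antisymm ?_ bot_le
  exact iInf₂_le_of_le 0 (map_zero (Lp.toTemperedDistributionCLM ℂ volume p)) (by simp)

theorem lpENorm_add_le (S T : 𝓢'(EuclideanSpace ℝ (Fin d), ℂ)) :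
    lpENorm p (S + T) ≤ lpENorm p S + lpENorm p T := by
  unfold lpENorm
  simp only [iInf_subtype', ENNReal.iInf_add, ENNReal.add_iInf]
  refine le_iInf fun f => le_iInf fun g => ?_
  refine iInf_le_of_le ⟨g.1 + f.1, ?_⟩ (enorm_add_le _ _)
  have := map_add (Lp.toTemperedDistributionCLM ℂ volume p) g.1 f.1
  simpa [f.2, g.2] using this

theorem lpENorm_smul_le (c : ℂ) (T : 𝓢'(EuclideanSpace ℝ (Fin d), ℂ)) :
    lpENorm p (c • T) ≤ ‖c‖ₑ * lpENorm p T := by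
  by_cases hc : c = 0
  · have h : (0 : ℂ) • T = 0 := zero_smul ℂ T
    rw [hc, h, lpENorm_zero]
    simp
  unfold lpENorm
  simp only [iInf_subtype']
  rw [ENNReal.mul_iInf_of_ne (by simpa using hc) (by simp)]
  refine le_iInf fun f => ?_
  refine iInf_le_of_le ⟨c • f.1, ?_⟩ (by rw [enorm_smul])
  have h1 := map_smul (Lp.toTemperedDistributionCLM ℂ volume p) c f.1
  have h2 : Lp.toTemperedDistributionCLM ℂ volume p f.1 = T := f.2
  rw [h2] at h1
  exact h1

end lpENorm

/-- The norm `‖f‖ = sup_m 2^{ms} ‖Δ_m f‖_{L^p}` of the homogeneous Besov space with third index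
`∞`, for a class `f` of tempered distributions modulo polynomials. -/
def besovENorm {d : ℕ} (χ : LPCutoff d) (s : ℝ) (p : ℝ≥0∞) [Fact (1 ≤ p)]
    (f : 𝓢'(EuclideanSpace ℝ (Fin d), ℂ) ⧸ polySubmodule d) : ℝ≥0∞ :=
  ⨆ m : ℤ, ENNReal.ofReal ((2 : ℝ) ^ ((m : ℝ) * s)) * lpENorm p (χ.blockMod m f)

section besov

variable {d : ℕ} (χ : LPCutoff d) (s : ℝ) (p : ℝ≥0∞) [Fact (1 ≤ p)]

theorem besovENorm_zero : besovENorm χ s p 0 = 0 := by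
  simp [besovENorm, lpENorm_zero]

theorem besovENorm_add_le (f g : 𝓢'(EuclideanSpace ℝ (Fin d), ℂ) ⧸ polySubmodule d) :
    besovENorm χ s p (f + g) ≤ besovENorm χ s p f + besovENorm χ s p g := by
  refine iSup_le fun m => ?_
  rw [map_add]
  calc _ ≤ ENNReal.ofReal ((2 : ℝ) ^ ((m : ℝ) * s)) *
        (lpENorm p (χ.blockMod m f) + lpENorm p (χ.blockMod m g)) := by
        gcongr; exact lpENorm_add_le p _ _
    _ ≤ _ := by
        rw [mul_add]
        exact add_le_add
          (le_iSup (fun m : ℤ => ENNReal.ofReal ((2 : ℝ) ^ ((m : ℝ) * s)) *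
            lpENorm p (χ.blockMod m f)) m)
          (le_iSup (fun m : ℤ => ENNReal.ofReal ((2 : ℝ) ^ ((m : ℝ) * s)) *
            lpENorm p (χ.blockMod m g)) m)

theorem besovENorm_smul_le (c : ℂ) (f : 𝓢'(EuclideanSpace ℝ (Fin d), ℂ) ⧸ polySubmodule d) :
    besovENorm χ s p (c • f) ≤ ‖c‖ₑ * besovENorm χ s p f := by
  refine iSup_le fun m => ?_
  rw [map_smul]
  calc _ ≤ ENNReal.ofReal ((2 : ℝ) ^ ((m : ℝ) * s)) * (‖c‖ₑ * lpENorm p (χ.blockMod m f)) := by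
        gcongr; exact lpENorm_smul_le p _ _
    _ = ‖c‖ₑ * (ENNReal.ofReal ((2 : ℝ) ^ ((m : ℝ) * s)) * lpENorm p (χ.blockMod m f)) := by
        ring
    _ ≤ _ := by
        gcongr
        exact le_iSup (fun m : ℤ => ENNReal.ofReal ((2 : ℝ) ^ ((m : ℝ) * s)) *
            lpENorm p (χ.blockMod m f)) m

/-- The classes modulo polynomials with finite Besov norm. -/
def besovSubmodule : Submodule ℂ (𝓢'(EuclideanSpace ℝ (Fin d), ℂ) ⧸ polySubmodule d) where
  carrier := {f | besovENorm χ s p f < ∞}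
  zero_mem' := by simp [besovENorm_zero]
  add_mem' := by
    intro f g hf hg
    exact (besovENorm_add_le χ s p f g).trans_lt (ENNReal.add_lt_top.2 ⟨hf, hg⟩)
  smul_mem' := by
    intro c f hf
    exact (besovENorm_smul_le χ s p c f).trans_lt (ENNReal.mul_lt_top (by simp) hf)

/-- The homogeneous Besov space with indices `s`, `p`, `∞`. It is a type of its own, since its
topology is the one of the Besov norm and not the one induced by tempered distributions. -/
def HomBesov : Type := besovSubmodule χ s p

instance : AddCommGroup (HomBesov χ s p) :=
  inferInstanceAs (AddCommGroup (besovSubmodule χ s p))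

instance : Module ℂ (HomBesov χ s p) :=
  inferInstanceAs (Module ℂ (besovSubmodule χ s p))

/-- The inclusion of the Besov space in the tempered distributions modulo polynomials. -/
def HomBesov.toQuotient :
    HomBesov χ s p →ₗ[ℂ] (𝓢'(EuclideanSpace ℝ (Fin d), ℂ) ⧸ polySubmodule d) :=
  (besovSubmodule χ s p).subtype

theorem HomBesov.besovENorm_ne_top (f : HomBesov χ s p) :
    besovENorm χ s p (HomBesov.toQuotient χ s p f) ≠ ∞ := ne_of_lt f.2

theorem HomBesov.toReal_smul_le (c : ℂ) (f : HomBesov χ s p) :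
    (besovENorm χ s p (HomBesov.toQuotient χ s p (c • f))).toReal ≤
      ‖c‖ * (besovENorm χ s p (HomBesov.toQuotient χ s p f)).toReal := by
  have h := besovENorm_smul_le χ s p c (HomBesov.toQuotient χ s p f)
  rw [← map_smul] at h
  have := ENNReal.toReal_mono
    (ENNReal.mul_ne_top (by simp) (HomBesov.besovENorm_ne_top χ s p f)) h
  simpa [ENNReal.toReal_mul] using this

/-- The Besov norm. Its definiteness holds too, because a tempered distribution whose Fourier
transform is supported at the origin is a polynomial, but no definition below needs it. -/
instance : SeminormedAddCommGroup (HomBesov χ s p) :=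
  AddGroupSeminorm.toSeminormedAddCommGroup
    { toFun := fun f => (besovENorm χ s p (HomBesov.toQuotient χ s p f)).toReal
      map_zero' := by simp [besovENorm_zero]
      add_le' := by
        intro f g
        rw [map_add, ← ENNReal.toReal_add (HomBesov.besovENorm_ne_top χ s p f)
          (HomBesov.besovENorm_ne_top χ s p g)]
        exact ENNReal.toReal_mono (ENNReal.add_ne_top.2
          ⟨HomBesov.besovENorm_ne_top χ s p f, HomBesov.besovENorm_ne_top χ s p g⟩)
          (besovENorm_add_le χ s p _ _)
      neg' := by
        intro f
        refine le_antisymm ?_ ?_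
        · simpa using HomBesov.toReal_smul_le χ s p (-1) f
        · simpa using HomBesov.toReal_smul_le χ s p (-1) (-f) }

theorem HomBesov.norm_def (f : HomBesov χ s p) :
    ‖f‖ = (besovENorm χ s p (HomBesov.toQuotient χ s p f)).toReal := rfl

instance : NormedSpace ℂ (HomBesov χ s p) where
  norm_smul_le c f := HomBesov.toReal_smul_le χ s p c f

/-- The dyadic block `Δ_m f` of an element of the Besov space. -/
def HomBesov.block (m : ℤ) (f : HomBesov χ s p) : 𝓢'(EuclideanSpace ℝ (Fin d), ℂ) :=
  χ.blockMod m (HomBesov.toQuotient χ s p f)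

/-- The space `C^s_p`: the closure, in the Besov space, of the set of classes that have a
representative in `S'_h`. -/
def closureHom : Submodule ℂ (HomBesov χ s p) :=
  ((χ.homDistributions.map (polySubmodule d).mkQ).comap
    (HomBesov.toQuotient χ s p)).topologicalClosure

end besov

/-! ### Sequence spaces -/

/-- Bounded complex sequences indexed by `ℕ`, with the supremum norm. -/
abbrev EllInfty : Type := lp (fun _ : ℕ => ℂ) ∞

/-- The subspace of sequences that converge to zero. -/
def cZero : Submodule ℂ EllInfty where
  carrier := {u | Tendsto (fun n => u n) atTop (𝓝 0)}
  zero_mem' := by simp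
  add_mem' := by
    intro u v hu hv
    simpa using Tendsto.add hu hv
  smul_mem' := by
    intro c u hu
    simpa using Tendsto.const_mul c hu

end

/-! Since `χ = 1` slightly beyond the unit ball, there is a shell `1 < |ξ| < 1 + ε` on which `φ = 1`
and every other `φ(2^j ·)` vanishes. Take `ψ` with a nonnegative Fourier transform supported there
and `ψ 0 = ∫ 𝓕 ψ ≠ 0`. Each bump `ψ(2^(-n) x)` then lives in the single block `-n`, so the sum `J u`
of the bumps `u n * 2^(nσ) * ψ(2^(-n) x)`, with `σ = s - d/p ≥ 0`, has Besov norm exactly `‖ψ‖_p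
‖u‖` (`exists_embedding`). The series need not converge in `𝓢'`. Subtracting from each bump its
Taylor polynomial at the origin, of order above `σ`, restores convergence
(`exists_weighted_dilates`) and changes nothing modulo polynomials.

Finitely supported sequences give finite sums of bumps, whose spectrum avoids the origin, hence
classes with representatives in `S'_h`; by density of such sequences in `c₀`, `J` maps `c₀` into
`C^s_p`.

For the lower bound (`exists_coeff_le`), pair `𝓕 (Δ_{-n} f)` with `χ`. The pairing tends to `0` for
`f ∈ S'_h`, equals `u n * 2^(nσ) * ψ 0` for `f = J u`, and is at most `C 2^(nσ) ‖f‖` by a Bernstein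
estimate. As `2^(nσ) ≥ 1`, the limsup of `|u n|` is at most a constant times the distance from `J u`
to `C^s_p`. That limsup is the norm of `u` in `ℓ^∞/c₀`.

Neither quotient is separable: binary sequences with every digit repeated infinitely often form an
uncountable family that is uniformly separated modulo `c₀`, and the lower bound carries it over to
the Besov quotient. -/

/-! ### Dyadic dilations of Schwartz functions -/

namespace SchwartzMap

variable {V : Type*} [NormedAddCommGroup V] [InnerProductSpace ℝ V]

/-- The dilation `f ↦ f(2^k ·)` of Schwartz functions. -/
noncomputable def dyadicDilate (k : ℤ) : 𝓢(V, ℂ) →L[ℂ] 𝓢(V, ℂ) :=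
  compCLMOfContinuousLinearEquiv ℂ
    (ContinuousLinearEquiv.smulLeft (R₁ := ℝ) (M₁ := V)
      (Units.mk0 ((2 : ℝ) ^ k) (zpow_ne_zero k two_ne_zero)))

@[simp]
theorem dyadicDilate_apply (k : ℤ) (f : 𝓢(V, ℂ)) (x : V) :
    dyadicDilate k f x = f ((2 : ℝ) ^ k • x) := rfl

variable [FiniteDimensional ℝ V] [MeasurableSpace V] [BorelSpace V]

theorem fourier_dyadicDilate (k : ℤ) (f : 𝓢(V, ℂ)) :
    𝓕 (dyadicDilate k f) =
      ((((2 : ℝ) ^ k) ^ Module.finrank ℝ V)⁻¹ : ℝ) • dyadicDilate (-k) (𝓕 f) := by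
  have h2 : (0 : ℝ) < 2 ^ k := by positivity
  ext ξ
  rw [smul_apply, dyadicDilate_apply, fourier_coe, fourier_coe, Real.fourier_eq', Real.fourier_eq']
  have := Measure.integral_comp_smul volume (fun v : V =>
    Complex.exp (↑(-2 * Real.pi * inner ℝ v ((2 : ℝ) ^ (-k) • ξ)) * Complex.I) • f v) ((2 : ℝ) ^ k)
  rw [abs_of_pos (by positivity)] at this
  rw [← this]
  congr 1
  ext v
  rw [inner_smul_left, inner_smul_right, dyadicDilate_apply]
  simp only [conj_trivial]
  rw [← mul_assoc ((2 : ℝ) ^ k), zpow_neg, mul_inv_cancel₀ h2.ne', one_mul]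

/-- Push the measure forward: Lebesgue measure is multiplied by a nonzero constant. With the
exponent written `(p⁻¹).toReal`, the case `p = ∞` needs no separate treatment. -/
theorem eLpNorm_dyadicDilate (k : ℤ) (f : 𝓢(V, ℂ)) (p : ℝ≥0∞) :
    eLpNorm (dyadicDilate k f) p volume =
      ENNReal.ofReal ((2 : ℝ) ^ (-((k : ℝ) * (Module.finrank ℝ V * (p⁻¹).toReal)))) *
        eLpNorm f p volume := by
  have h2 : (0 : ℝ) < 2 ^ k := by positivity
  have h1 : eLpNorm (dyadicDilate k f) p volume =
      eLpNorm f p (Measure.map (fun x : V => (2 : ℝ) ^ k • x) volume) := by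
    rw [eLpNorm_map_measure f.continuous.aestronglyMeasurable (by fun_prop)]
    rfl
  have h3 : (0 : ℝ) < (((2 : ℝ) ^ k) ^ Module.finrank ℝ V)⁻¹ := by positivity
  rw [h1, Measure.map_addHaar_smul _ h2.ne', eLpNorm_smul_measure_of_ne_zero, smul_eq_mul,
    abs_of_pos h3, ENNReal.ofReal_rpow_of_pos h3]
  · congr 2
    rw [← zpow_natCast, ← zpow_mul, ← zpow_neg, ← Real.rpow_intCast, ← Real.rpow_mul (by norm_num)]
    congr 1
    rw [one_div]
    push_cast
    ring
  · rw [abs_of_pos h3]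
    simpa using h3

end SchwartzMap

/-! ### The `L^p` norm of a tempered distribution -/

section lpENorm

variable {d : ℕ} (p : ℝ≥0∞) [Fact (1 ≤ p)]

/-- Functions in `L^p` embed injectively in the tempered distributions, so the infimum runs over one
element. -/
theorem lpENorm_toTemperedDistribution
    (f : Lp ℂ p (volume : Measure (EuclideanSpace ℝ (Fin d)))) :
    lpENorm p (Lp.toTemperedDistribution f) = ‖f‖ₑ := by
  refine le_antisymm (iInf₂_le_of_le f rfl le_rfl) (le_iInf₂ fun g hg => ?_)
  have h := LinearMap.ker_eq_bot.1 (Lp.ker_toTemperedDistributionCLM_eq_bot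
    (F := ℂ) (μ := (volume : Measure (EuclideanSpace ℝ (Fin d)))) (p := p))
  rw [h (a₁ := g) (a₂ := f) hg]

theorem lpENorm_schwartz (f : 𝓢(EuclideanSpace ℝ (Fin d), ℂ)) :
    lpENorm p (SchwartzMap.toTemperedDistributionCLM _ ℂ volume f) = eLpNorm f p volume := by
  rw [← Lp.toTemperedDistribution_toLp_eq (p := p), lpENorm_toTemperedDistribution]
  simp only [SchwartzMap.toLp, Lp.enorm_toLp]

theorem lpENorm_smul (c : ℂ) (T : 𝓢'(EuclideanSpace ℝ (Fin d), ℂ)) :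
    lpENorm p (c • T) = ‖c‖ₑ * lpENorm p T := by
  refine le_antisymm (lpENorm_smul_le p c T) ?_
  rcases eq_or_ne c 0 with rfl | hc
  · simp
  have h := lpENorm_smul_le p c⁻¹ (c • T)
  have h1 : c⁻¹ • c • T = T := inv_smul_smul₀ hc T
  rw [h1] at h
  calc ‖c‖ₑ * lpENorm p T ≤ ‖c‖ₑ * (‖c⁻¹‖ₑ * lpENorm p (c • T)) := by gcongr
    _ = lpENorm p (c • T) := by
      rw [← mul_assoc, ← enorm_mul, mul_inv_cancel₀ hc, enorm_one, one_mul]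

/-- Hölder with the conjugate exponent `(1 - p⁻¹)⁻¹`, which correctly gives `∞` at `p = 1` and `1`
at `p = ∞`. Finiteness of the norm supplies the function representing `T`. -/
theorem enorm_apply_le_lpENorm_mul (T : 𝓢'(EuclideanSpace ℝ (Fin d), ℂ))
    (g : 𝓢(EuclideanSpace ℝ (Fin d), ℂ)) (hT : lpENorm p T ≠ ∞) :
    ‖T g‖ₑ ≤ lpENorm p T * eLpNorm g (1 - p⁻¹)⁻¹ volume := by
  have hp : Fact (1 ≤ p) := inferInstance
  have := ENNReal.HolderConjugate.inv_one_sub_inv' hp.out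
  obtain ⟨f, hf⟩ : ∃ f : Lp ℂ p (volume : Measure (EuclideanSpace ℝ (Fin d))),
      Lp.toTemperedDistribution f = T := by
    by_contra! h
    exact hT (by simp [lpENorm, h])
  rw [← hf, lpENorm_toTemperedDistribution, Lp.toTemperedDistribution_apply]
  have h1 : ‖∫ x, g x • f x‖ₑ ≤ eLpNorm (⇑g • ⇑f) 1 volume := by
    rw [eLpNorm_one_eq_lintegral_enorm]
    exact enorm_integral_le_lintegral_enorm _
  have h2 : eLpNorm (⇑g • ⇑f) 1 volume ≤ eLpNorm g (1 - p⁻¹)⁻¹ volume * eLpNorm f p volume :=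
    eLpNorm_smul_le_mul_eLpNorm (p := (1 - p⁻¹)⁻¹) (q := p) (r := 1)
      (Lp.aestronglyMeasurable f) g.continuous.aestronglyMeasurable
  rw [Lp.enorm_def, mul_comm]
  exact h1.trans h2

end lpENorm

/-! ### Taylor polynomials of Schwartz functions -/

/-- For `|t| ≤ 1` this is the exponential remainder with `e < 3`; for `|t| ≥ 1` the exponential and
each of the `N` Taylor terms are at most `|t|^N`. -/
theorem Complex.norm_exp_mul_I_sub_sum_le (N : ℕ) (t : ℝ) :
    ‖Complex.exp (t * Complex.I) - ∑ k ∈ Finset.range N, (t * Complex.I) ^ k / (k.factorial : ℂ)‖ ≤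
      (N + 3) * |t| ^ N := by
  have hn : ‖(t : ℂ) * Complex.I‖ = |t| := by simp
  rcases le_total |t| 1 with h | h
  · refine (Complex.norm_exp_sub_sum_le_norm_mul_exp _ N).trans ?_
    rw [hn, mul_comm]
    gcongr
    have := Real.exp_le_exp.2 h
    have := Real.exp_one_lt_three
    have : (0 : ℝ) ≤ N := by positivity
    linarith
  · refine (norm_sub_le _ _).trans ?_
    rw [Complex.norm_exp_ofReal_mul_I]
    have h1 : ‖∑ k ∈ Finset.range N, (t * Complex.I) ^ k / (k.factorial : ℂ)‖ ≤ N * |t| ^ N := by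
      refine (norm_sum_le_of_le (f := fun k => (t * Complex.I) ^ k / (k.factorial : ℂ))
        (Finset.range N) (n := fun _ => |t| ^ N) fun k hk => ?_).trans (by simp)
      rw [norm_div, norm_pow, hn, Complex.norm_natCast]
      refine (div_le_self (by positivity) (by exact_mod_cast k.factorial_pos)).trans ?_
      exact pow_le_pow_right₀ h (Finset.mem_range.1 hk).le
    have h2 : 1 ≤ |t| ^ N := one_le_pow₀ h
    linarith

section Taylor

variable {d : ℕ}

theorem SchwartzMap.integrable_inner_pow_mul (θ : 𝓢(EuclideanSpace ℝ (Fin d), ℂ)) (k : ℕ)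
    (x : EuclideanSpace ℝ (Fin d)) : Integrable (fun ξ => ((inner ℝ ξ x : ℝ) : ℂ) ^ k * θ ξ) := by
  have hg : Function.HasTemperateGrowth
      (fun ξ : EuclideanSpace ℝ (Fin d) => ((inner ℝ ξ x : ℝ) : ℂ) ^ k) := by
    have : Function.HasTemperateGrowth
      (fun ξ : EuclideanSpace ℝ (Fin d) => ((inner ℝ ξ x : ℝ) : ℂ)) := by fun_prop
    exact this.pow k
  have := (SchwartzMap.smulLeftCLM ℂ
    (fun ξ : EuclideanSpace ℝ (Fin d) => ((inner ℝ ξ x : ℝ) : ℂ) ^ k) θ).integrable (μ := volume)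
  simpa [SchwartzMap.smulLeftCLM_apply hg] using this

/-- Expand one factor `⟨ξ, x⟩ = ∑ ξ i * x i` and absorb `ξ i` into `θ`; hence the induction on `k`
must hold for all `θ` at once. -/
theorem SchwartzMap.exists_mvPolynomial_moment (k : ℕ) :
    ∀ θ : 𝓢(EuclideanSpace ℝ (Fin d), ℂ), ∃ Q : MvPolynomial (Fin d) ℂ,
      ∀ x : EuclideanSpace ℝ (Fin d), MvPolynomial.eval (fun i => (x i : ℂ)) Q =
        ∫ ξ, ((inner ℝ ξ x : ℝ) : ℂ) ^ k * θ ξ := by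
  induction k with
  | zero => exact fun θ => ⟨MvPolynomial.C (∫ ξ, θ ξ), fun x => by simp⟩
  | succ k ih =>
    intro θ
    have hc : ∀ i, Function.HasTemperateGrowth
        (fun ξ : EuclideanSpace ℝ (Fin d) => (ξ i : ℂ)) := fun i => by
      have h1 : Function.HasTemperateGrowth (fun x : EuclideanSpace ℝ (Fin d) => x i) :=
        (EuclideanSpace.proj (𝕜 := ℝ) i).hasTemperateGrowth
      fun_prop
    choose Q hQ using fun i : Fin d => ih (SchwartzMap.smulLeftCLM ℂ
      (fun ξ : EuclideanSpace ℝ (Fin d) => (ξ i : ℂ)) θ)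
    refine ⟨∑ i, MvPolynomial.X i * Q i, fun x => ?_⟩
    simp only [map_sum, map_mul, MvPolynomial.eval_X, hQ]
    simp_rw [← integral_const_mul]
    rw [← integral_finsetSum _ fun i _ => (SchwartzMap.integrable_inner_pow_mul _ k x).const_mul _]
    congr 1
    ext ξ
    simp only [SchwartzMap.smulLeftCLM_apply_apply (hc _), smul_eq_mul]
    rw [pow_succ, PiLp.inner_apply]
    push_cast
    rw [Finset.mul_sum, Finset.sum_mul]
    refine Finset.sum_congr rfl fun i _ => ?_
    simp
    ring

/-- A Schwartz function differs from its Taylor polynomial at the origin by `O(|x|^N)`, globally. -/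
theorem SchwartzMap.exists_mvPolynomial_norm_sub_le (ψ : 𝓢(EuclideanSpace ℝ (Fin d), ℂ)) (N : ℕ) :
    ∃ (P : MvPolynomial (Fin d) ℂ) (C : ℝ), 0 ≤ C ∧ ∀ x : EuclideanSpace ℝ (Fin d),
      ‖ψ x - MvPolynomial.eval (fun i => (x i : ℂ)) P‖ ≤ C * ‖x‖ ^ N := by
  set θ := 𝓕 ψ with hθ
  choose Q hQ using fun k => SchwartzMap.exists_mvPolynomial_moment k θ
  set a : ℂ := 2 * Real.pi * Complex.I
  -- The Taylor polynomial comes from truncating the exponential series in Fourier inversion: its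
  -- coefficients are moments of `𝓕 ψ`, and the remainder is controlled by the `N`-th absolute
  -- moment.
  refine ⟨∑ k ∈ Finset.range N, MvPolynomial.C (a ^ k / (k.factorial : ℂ)) * Q k,
    (N + 3) * (2 * Real.pi) ^ N * ∫ ξ, ‖ξ‖ ^ N * ‖θ ξ‖, by positivity, fun x => ?_⟩
  have h1 : ψ x = ∫ ξ, Complex.exp (↑(2 * Real.pi * inner ℝ ξ x) * Complex.I) * θ ξ := by
    have h : ψ = 𝓕⁻ θ := (FourierTransform.fourierInv_fourier_eq ψ).symm
    conv_lhs => rw [h, SchwartzMap.fourierInv_coe]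
    rw [Real.fourierInv_eq']
    rfl
  have h2 : MvPolynomial.eval (fun i => (x i : ℂ))
      (∑ k ∈ Finset.range N, MvPolynomial.C (a ^ k / (k.factorial : ℂ)) * Q k) =
      ∫ ξ, (∑ k ∈ Finset.range N,
        (↑(2 * Real.pi * inner ℝ ξ x) * Complex.I) ^ k / (k.factorial : ℂ)) * θ ξ := by
    simp only [map_sum, map_mul, MvPolynomial.eval_C, hQ]
    simp_rw [← integral_const_mul]
    rw [← integral_finsetSum _ fun i _ => (SchwartzMap.integrable_inner_pow_mul _ i x).const_mul _]
    congr 1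
    ext ξ
    rw [Finset.sum_mul]
    refine Finset.sum_congr rfl fun k _ => ?_
    simp only [a]
    push_cast
    ring
  have h3 : Integrable fun ξ =>
      Complex.exp (↑(2 * Real.pi * inner ℝ ξ x) * Complex.I) * θ ξ := by
    refine (θ.integrable (μ := volume)).bdd_mul (c := 1)
      (Continuous.aestronglyMeasurable (by fun_prop)) (Eventually.of_forall fun ξ => ?_)
    rw [Complex.norm_exp_ofReal_mul_I]
  have h4 : Integrable fun ξ => (∑ k ∈ Finset.range N,
        (↑(2 * Real.pi * inner ℝ ξ x) * Complex.I) ^ k / (k.factorial : ℂ)) * θ ξ := by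
    simp_rw [Finset.sum_mul]
    refine integrable_finsetSum _ fun k _ => ?_
    refine ((SchwartzMap.integrable_inner_pow_mul θ k x).const_mul
      (a ^ k / (k.factorial : ℂ))).congr (Eventually.of_forall fun ξ => ?_)
    simp only [a]
    push_cast
    ring
  rw [h1, h2, ← integral_sub h3 h4, ← integral_const_mul, ← integral_mul_const]
  refine norm_integral_le_of_norm_le
    (((SchwartzMap.integrable_pow_mul volume θ N).const_mul _).mul_const _)
    (Eventually.of_forall fun ξ => ?_)
  rw [← sub_mul, norm_mul]
  have h5 : |2 * Real.pi * inner ℝ ξ x| ≤ 2 * Real.pi * (‖ξ‖ * ‖x‖) := by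
    rw [abs_mul, abs_of_pos Real.two_pi_pos]
    gcongr
    exact abs_real_inner_le_norm ξ x
  calc _ ≤ ((N + 3) * |2 * Real.pi * inner ℝ ξ x| ^ N) * ‖θ ξ‖ := by
        gcongr
        exact Complex.norm_exp_mul_I_sub_sum_le N _
    _ ≤ ((N + 3) * (2 * Real.pi * (‖ξ‖ * ‖x‖)) ^ N) * ‖θ ξ‖ := by gcongr
    _ = _ := by ring

end Taylor

/-- Smooth bumps as Schwartz functions. -/
theorem exists_schwartz_bump {V : Type*} [NormedAddCommGroup V] [InnerProductSpace ℝ V]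
    [FiniteDimensional ℝ V] [MeasurableSpace V] [BorelSpace V] (c : V) {δ : ℝ} (hδ : 0 < δ) :
    ∃ (θ : 𝓢(V, ℂ)) (r : V → ℝ), (∀ ξ, 0 ≤ r ξ) ∧ (∀ ξ, θ ξ = (r ξ : ℂ)) ∧
      (∀ ξ, θ ξ ≠ 0 → ‖ξ - c‖ < δ) ∧ ∫ ξ, θ ξ ≠ 0 := by
  let b : ContDiffBump c := ⟨δ / 2, δ, by positivity, by linarith⟩
  have hb : HasCompactSupport (fun ξ => (b ξ : ℂ)) :=
    b.hasCompactSupport.comp_left Complex.ofReal_zero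
  have hs : ContDiff ℝ (⊤ : ℕ∞) (fun ξ => (b ξ : ℂ)) := Complex.ofRealCLM.contDiff.comp b.contDiff
  refine ⟨hb.toSchwartzMap hs, b, fun ξ => b.nonneg, fun ξ => hb.toSchwartzMap_toFun hs ξ,
    fun ξ hξ => ?_, ?_⟩
  · rw [hb.toSchwartzMap_toFun hs, ne_eq, Complex.ofReal_eq_zero] at hξ
    have hm : ξ ∈ Function.support b := hξ
    rw [b.support_eq, mem_ball_iff_norm] at hm
    exact hm
  · simp_rw [hb.toSchwartzMap_toFun hs]
    rw [integral_complex_ofReal]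
    exact_mod_cast (b.integral_pos (μ := volume)).ne'

/-! ### The Littlewood-Paley cut-off -/

namespace LPCutoff

variable {d : ℕ} (χ : LPCutoff d)

theorem eq_zero_of_two_lt {ξ : EuclideanSpace ℝ (Fin d)} (h : 2 < ‖ξ‖) : χ.toFun ξ = 0 := by
  refine image_eq_zero_of_notMem_tsupport fun hm => ?_
  have := χ.support_subset hm
  rw [mem_closedBall_zero_iff] at this
  linarith

theorem eq_one_of_le_one {ξ : EuclideanSpace ℝ (Fin d)} (h : ‖ξ‖ ≤ 1) : χ.toFun ξ = 1 := by
  have := subset_of_mem_nhdsSet χ.eq_one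
  exact this (mem_closedBall_zero_iff.2 h)

/-- By compactness, a neighborhood of the closed ball contains a uniform thickening. This makes room
for the shell that carries `𝓕 ψ`. -/
theorem exists_eq_one_of_norm_lt :
    ∃ ε : ℝ, 0 < ε ∧ ∀ ξ : EuclideanSpace ℝ (Fin d), ‖ξ‖ < 1 + ε → χ.toFun ξ = 1 := by
  obtain ⟨δ, hδ, h⟩ := (isCompact_closedBall (0 : EuclideanSpace ℝ (Fin d)) 1).exists_thickening_subset_open
    isOpen_interior (subset_interior_iff_mem_nhdsSet.2 χ.eq_one)
  refine ⟨δ, hδ, fun ξ hξ => ?_⟩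
  have : ξ ∈ {x | χ.toFun x = 1} := interior_subset (h ?_)
  · exact this
  rw [thickening_closedBall hδ zero_le_one]
  simpa [add_comm] using hξ

/-- Both terms of `φ(2^j η)` are `1` for `j < 0` and both are `0` for `j > 0`. At `j = 0` they are
`1` and `0`, because `2‖η‖ > 2`. -/
theorem annulus_zpow_smul {η : EuclideanSpace ℝ (Fin d)} (h1 : 1 < ‖η‖)
    (h2 : ∀ ζ : EuclideanSpace ℝ (Fin d), ‖ζ‖ ≤ ‖η‖ → χ.toFun ζ = 1) (j : ℤ) :
    χ.annulus ((2 : ℝ) ^ j • η) = if j = 0 then 1 else 0 := by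
  have hn : ∀ k : ℤ, ‖(2 : ℝ) ^ k • η‖ = 2 ^ k * ‖η‖ := fun k => by
    rw [norm_smul, norm_zpow]; simp
  have hz : ∀ k : ℤ, 1 ≤ k → χ.toFun ((2 : ℝ) ^ k • η) = 0 := fun k hk => by
    apply χ.eq_zero_of_two_lt
    rw [hn]
    have : (2 : ℝ) ^ (1 : ℤ) ≤ 2 ^ k := zpow_le_zpow_right₀ (by norm_num) hk
    rw [zpow_one] at this
    nlinarith
  have ho : ∀ k : ℤ, k ≤ 0 → χ.toFun ((2 : ℝ) ^ k • η) = 1 := fun k hk => by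
    apply h2
    rw [hn]
    have : (2 : ℝ) ^ k ≤ 1 := zpow_le_one_of_nonpos₀ (by norm_num) hk
    nlinarith
  rw [annulus, smul_smul, ← zpow_one_add₀ two_ne_zero]
  rcases lt_trichotomy j 0 with h | h | h
  · rw [ho j h.le, ho _ (by omega), if_neg h.ne, sub_self]
  · rw [ho j h.le, hz _ (by omega), if_pos h, sub_zero]
  · rw [hz j h, hz _ (by omega), if_neg h.ne', sub_self]

theorem annulus_eq_zero_of_two_lt {ξ : EuclideanSpace ℝ (Fin d)} (h : 2 < ‖ξ‖) :
    χ.annulus ξ = 0 := by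
  rw [annulus, χ.eq_zero_of_two_lt h, χ.eq_zero_of_two_lt, sub_zero]
  rw [norm_smul, Real.norm_two]
  linarith

/-- The cut-off as a complex valued Schwartz function. -/
noncomputable def schwartz : 𝓢(EuclideanSpace ℝ (Fin d), ℂ) :=
  HasCompactSupport.toSchwartzMap (f := fun ξ => (χ.toFun ξ : ℂ))
    ((HasCompactSupport.intro' (isCompact_closedBall 0 2) Metric.isClosed_closedBall
      fun ξ hξ => by
        simp only [mem_closedBall_zero_iff, not_le] at hξ
        simp [χ.eq_zero_of_two_lt hξ]))
    (Complex.ofRealCLM.contDiff.comp χ.smooth)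

@[simp]
theorem schwartz_apply (ξ : EuclideanSpace ℝ (Fin d)) : χ.schwartz ξ = (χ.toFun ξ : ℂ) := rfl

theorem lowSymbol_hasTemperateGrowth (lam : ℝ) : (χ.lowSymbol lam).HasTemperateGrowth :=
  χ.schwartz.hasTemperateGrowth.comp
    (lam • ContinuousLinearMap.id ℝ (EuclideanSpace ℝ (Fin d))).hasTemperateGrowth

theorem dyadicSymbol_eq_sub (m : ℤ) :
    χ.dyadicSymbol m = χ.lowSymbol ((2 : ℝ) ^ (-m)) - χ.lowSymbol ((2 : ℝ) ^ (1 - m)) := by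
  ext ξ
  rw [dyadicSymbol, annulus, smul_smul, ← zpow_one_add₀ two_ne_zero, ← sub_eq_add_neg]
  push_cast
  rfl

theorem dyadicSymbol_hasTemperateGrowth (m : ℤ) : (χ.dyadicSymbol m).HasTemperateGrowth := by
  rw [dyadicSymbol_eq_sub]
  exact (χ.lowSymbol_hasTemperateGrowth _).sub (χ.lowSymbol_hasTemperateGrowth _)

/-- `ψ` is a Schwartz function whose Fourier transform is supported in the region `|ξ| > 1` of the
ball on which the cut-off is `1`. -/
def IsAnnular (ψ : 𝓢(EuclideanSpace ℝ (Fin d), ℂ)) : Prop :=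
  ∀ ξ, 𝓕 ψ ξ ≠ 0 → 1 < ‖ξ‖ ∧ ∀ ζ : EuclideanSpace ℝ (Fin d), ‖ζ‖ ≤ ‖ξ‖ → χ.toFun ζ = 1

theorem exists_isAnnular (hd : 0 < d) : ∃ ψ : 𝓢(EuclideanSpace ℝ (Fin d), ℂ),
    χ.IsAnnular ψ ∧ (∀ ξ, ∃ r : ℝ, 0 ≤ r ∧ 𝓕 ψ ξ = (r : ℂ)) ∧ ψ 0 ≠ 0 := by
  obtain ⟨ε, hε, h1⟩ := χ.exists_eq_one_of_norm_lt
  -- A ball of radius `ε / 4` around a point of norm `1 + ε / 2` stays inside the shell. Such a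
  -- point exists because `d > 0`.
  set c : EuclideanSpace ℝ (Fin d) := EuclideanSpace.single ⟨0, hd⟩ (1 + ε / 2) with hc
  have hcn : ‖c‖ = 1 + ε / 2 := by
    rw [hc, PiLp.norm_single, Real.norm_of_nonneg (by positivity)]
  obtain ⟨θ, r, hr, hθ, hθs, hθi⟩ := exists_schwartz_bump c (δ := ε / 4) (by positivity)
  have hF : 𝓕 (𝓕⁻ θ) = θ := FourierTransform.fourier_fourierInv_eq θ
  refine ⟨𝓕⁻ θ, ?_, ?_, ?_⟩
  · intro ξ hξ
    rw [hF] at hξ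
    have hm' := hθs ξ hξ
    have h2 := norm_sub_norm_le ξ c
    have h3 := norm_sub_norm_le c ξ
    rw [norm_sub_rev] at h3
    exact ⟨by linarith, fun ζ hζ => h1 ζ (by linarith)⟩
  · exact fun ξ => ⟨r ξ, hr ξ, by rw [hF, hθ]⟩
  · rw [SchwartzMap.fourierInv_coe, Real.fourierInv_eq]
    simpa using hθi

variable {χ}

theorem IsAnnular.annulus_mul {ψ : 𝓢(EuclideanSpace ℝ (Fin d), ℂ)} (h : χ.IsAnnular ψ)
    (j : ℤ) (ξ : EuclideanSpace ℝ (Fin d)) :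
    (χ.annulus ((2 : ℝ) ^ j • ξ) : ℂ) * 𝓕 ψ ξ = if j = 0 then 𝓕 ψ ξ else 0 := by
  by_cases h0 : 𝓕 ψ ξ = 0
  · simp [h0]
  · rw [χ.annulus_zpow_smul (h ξ h0).1 (h ξ h0).2]
    split_ifs <;> simp

theorem IsAnnular.block_dyadicDilate {ψ : 𝓢(EuclideanSpace ℝ (Fin d), ℂ)} (h : χ.IsAnnular ψ)
    (m n : ℤ) :
    χ.block m (SchwartzMap.toTemperedDistributionCLM _ ℂ volume (SchwartzMap.dyadicDilate n ψ)) =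
      if m = n then
        SchwartzMap.toTemperedDistributionCLM _ ℂ volume (SchwartzMap.dyadicDilate n ψ)
      else 0 := by
  rw [block, TemperedDistribution.fourierMultiplierCLM_toTemperedDistributionCLM_eq
    (χ.dyadicSymbol_hasTemperateGrowth m), SchwartzMap.fourierMultiplierCLM_apply]
  have h1 : SchwartzMap.smulLeftCLM ℂ (χ.dyadicSymbol m) (𝓕 (SchwartzMap.dyadicDilate n ψ)) =
      if m = n then 𝓕 (SchwartzMap.dyadicDilate n ψ) else 0 := by
    ext ξ
    rw [SchwartzMap.smulLeftCLM_apply_apply (χ.dyadicSymbol_hasTemperateGrowth m),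
      SchwartzMap.fourier_dyadicDilate]
    -- The spectrum of the dilate is the shell scaled by `2^n`; rescaled to the original shell, the
    -- symbol at level `m` becomes `φ(2^(n - m) ·)`.
    have h2 := h.annulus_mul (n - m) ((2 : ℝ) ^ (-n) • ξ)
    rw [smul_smul, ← zpow_add₀ two_ne_zero, show n - m + -n = -m by ring] at h2
    have h3 : χ.dyadicSymbol m ξ * 𝓕 ψ ((2 : ℝ) ^ (-n) • ξ) =
        if m = n then 𝓕 ψ ((2 : ℝ) ^ (-n) • ξ) else 0 := by
      rw [dyadicSymbol, h2]
      simp only [sub_eq_zero, eq_comm]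
    rw [smul_apply, SchwartzMap.dyadicDilate_apply, smul_eq_mul, mul_smul_comm, h3]
    split_ifs
    · simp
    · simp
  rw [h1]
  split_ifs
  · rw [FourierTransform.fourierInv_fourier_eq]
  · rw [FourierTransform.fourierInv_zero, map_zero]

/-- The spectrum lies in `|ξ| > 2^n`, so once `lam > 2 * 2^(-n)` the cut-off `χ(lam ξ)` vanishes on
it and the product is exactly zero. -/
theorem IsAnnular.dyadicDilate_mem_homDistributions {ψ : 𝓢(EuclideanSpace ℝ (Fin d), ℂ)}
    (h : χ.IsAnnular ψ) (n : ℤ) :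
    SchwartzMap.toTemperedDistributionCLM _ ℂ volume (SchwartzMap.dyadicDilate n ψ) ∈
      χ.homDistributions := by
  refine tendsto_const_nhds.congr' ?_
  filter_upwards [eventually_gt_atTop ((2 : ℝ) * 2 ^ (-n))] with lam hlam
  have h2 : (0 : ℝ) < 2 ^ (-n) := by positivity
  ext g
  rw [TemperedDistribution.smulLeftCLM_apply_apply,
    TemperedDistribution.fourier_toTemperedDistributionCLM_eq]
  symm
  refine (SchwartzMap.toTemperedDistributionCLM_apply_apply volume _ _).trans ?_
  refine integral_eq_zero_of_ae (Eventually.of_forall fun ξ => ?_)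
  dsimp only [Pi.zero_apply]
  rw [SchwartzMap.smulLeftCLM_apply_apply (χ.lowSymbol_hasTemperateGrowth lam),
    SchwartzMap.fourier_dyadicDilate, smul_apply, SchwartzMap.dyadicDilate_apply]
  by_cases h0 : 𝓕 ψ ((2 : ℝ) ^ (-n) • ξ) = 0
  · simp only [h0, smul_zero]
  · have h1 := (h _ h0).1
    have h3 : χ.toFun (lam • ξ) = 0 := by
      apply χ.eq_zero_of_two_lt
      rw [norm_smul, norm_zpow, Real.norm_two] at h1
      rw [norm_smul, Real.norm_of_nonneg (by linarith)]
      have : 0 < ‖ξ‖ := by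
        by_contra! h4
        nlinarith
      nlinarith
    simp [lowSymbol, h3]

variable (χ)

/-! ### Testing dyadic blocks against the cut-off -/

theorem fourier_block_apply (m : ℤ) (f : 𝓢'(EuclideanSpace ℝ (Fin d), ℂ))
    (g : 𝓢(EuclideanSpace ℝ (Fin d), ℂ)) :
    𝓕 (χ.block m f) g = 𝓕 f (SchwartzMap.smulLeftCLM ℂ (χ.dyadicSymbol m) g) := by
  rw [block, TemperedDistribution.fourierMultiplierCLM_apply,
    FourierTransform.fourier_fourierInv_eq, TemperedDistribution.smulLeftCLM_apply_apply]

/-- The symbol vanishes for `|ξ| > 2 * 2^(-n)`, and elsewhere both `χ(ξ)` and `χ(2^(n-1) ξ)` equal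
`1`. Replacing `χ` by a dilate at the scale of the block is what produces the Bernstein gain. -/
theorem smulLeftCLM_dyadicSymbol_schwartz {n : ℤ} (hn : 1 ≤ n) :
    SchwartzMap.smulLeftCLM ℂ (χ.dyadicSymbol (-n)) χ.schwartz =
      SchwartzMap.smulLeftCLM ℂ (χ.dyadicSymbol (-n))
        (SchwartzMap.dyadicDilate (n - 1) χ.schwartz) := by
  ext ξ
  simp only [SchwartzMap.smulLeftCLM_apply_apply (χ.dyadicSymbol_hasTemperateGrowth _),
    SchwartzMap.dyadicDilate_apply, schwartz_apply, dyadicSymbol, neg_neg]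
  by_cases h : 2 < ‖(2 : ℝ) ^ n • ξ‖
  · rw [χ.annulus_eq_zero_of_two_lt h]
    simp
  · rw [norm_smul, norm_zpow, Real.norm_two, not_lt] at h
    have h1 : (2 : ℝ) ^ n = 2 ^ (n - 1) * 2 := by
      rw [← zpow_add_one₀ two_ne_zero, sub_add_cancel]
    have h2 : (1 : ℝ) ≤ 2 ^ (n - 1) := one_le_zpow₀ (by norm_num) (by omega)
    have h3 := norm_nonneg ξ
    rw [χ.eq_one_of_le_one (ξ := ξ) (by nlinarith), χ.eq_one_of_le_one]
    rw [norm_smul, norm_zpow, Real.norm_two]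
    nlinarith

/-- The symbol of `Δ_{-n}` is the difference of the low-frequency cut-offs with `lam = 2^n` and `lam
= 2^(n+1)`, and both contributions tend to `0` by definition of `S'_h`. -/
theorem tendsto_fourier_block_apply {f : 𝓢'(EuclideanSpace ℝ (Fin d), ℂ)}
    (hf : f ∈ χ.homDistributions) (g : 𝓢(EuclideanSpace ℝ (Fin d), ℂ)) :
    Tendsto (fun n : ℕ => 𝓕 (χ.block (-(n : ℤ)) f) g) atTop (𝓝 0) := by
  have h1 : Tendsto (fun lam : ℝ => 𝓕 f (SchwartzMap.smulLeftCLM ℂ (χ.lowSymbol lam) g))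
      atTop (𝓝 0) := by
    exact PointwiseConvergenceCLM.tendsto_iff_forall_tendsto.1 hf g
  have h2 : Tendsto (fun n : ℕ => (2 : ℝ) ^ n) atTop atTop :=
    tendsto_pow_atTop_atTop_of_one_lt one_lt_two
  have h3 := (h1.comp h2).sub (h1.comp ((tendsto_add_atTop_iff_nat 1).2 h2))
  rw [sub_zero] at h3
  refine h3.congr fun n => ?_
  rw [fourier_block_apply, dyadicSymbol_eq_sub, SchwartzMap.smulLeftCLM_sub
    (χ.lowSymbol_hasTemperateGrowth _) (χ.lowSymbol_hasTemperateGrowth _)]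
  rw [sub_apply, map_sub, neg_neg, sub_neg_eq_add, add_comm (1 : ℤ)]
  norm_cast

/-- On blocks of frequency `2^(-n)`, testing against the cut-off is controlled by the `L^p` norm,
with the gain given by Bernstein's inequality. -/
theorem exists_norm_fourier_block_apply_le (p : ℝ≥0∞) [Fact (1 ≤ p)] :
    ∃ C : ℝ, 0 ≤ C ∧ ∀ (f : 𝓢'(EuclideanSpace ℝ (Fin d), ℂ)) (n : ℤ), 1 ≤ n →
      lpENorm p (χ.block (-n) f) ≠ ∞ →
      ‖𝓕 (χ.block (-n) f) χ.schwartz‖ ≤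
        C * 2 ^ (-((n : ℝ) * (d * (p⁻¹).toReal))) * (lpENorm p (χ.block (-n) f)).toReal := by
  have hp : Fact (1 ≤ p) := inferInstance
  set q : ℝ≥0∞ := (1 - p⁻¹)⁻¹ with hq
  set F : 𝓢(EuclideanSpace ℝ (Fin d), ℂ) := 𝓕 χ.schwartz with hF
  -- The factor `2^(d/p)` pays for dilating by `2^(n-1)` instead of `2^n`.
  refine ⟨2 ^ ((d : ℝ) * (p⁻¹).toReal) * (eLpNorm F q volume).toReal,
    by positivity, fun f n hn hf => ?_⟩
  set G : 𝓢(EuclideanSpace ℝ (Fin d), ℂ) :=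
    𝓕 (SchwartzMap.dyadicDilate (n - 1) χ.schwartz) with hG
  have h1 : 𝓕 (χ.block (-n) f) χ.schwartz = χ.block (-n) f G := by
    rw [fourier_block_apply, smulLeftCLM_dyadicSymbol_schwartz χ hn, ← fourier_block_apply]
    rfl
  have h2 := enorm_apply_le_lpENorm_mul p _ G hf
  have hqp : (q⁻¹).toReal = 1 - (p⁻¹).toReal := by
    rw [hq, inv_inv, ENNReal.toReal_sub_of_le (ENNReal.inv_le_one.2 hp.out) ENNReal.one_ne_top,
      ENNReal.toReal_one]
  -- The Fourier transform of the dilate gives `2^(-(n-1)d)` and the `L^q` scaling gives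
  -- `2^((n-1)d/q)`; since `1/q = 1 - 1/p`, there remains `2^(-(n-1)d/p)`.
  have h3 : eLpNorm G q volume =
      ENNReal.ofReal (2 ^ (-(((n : ℝ) - 1) * (d * (p⁻¹).toReal)))) *
        eLpNorm F q volume := by
    have h4 : (0 : ℝ) < ((2 ^ (n - 1)) ^ d)⁻¹ := by positivity
    rw [hG, SchwartzMap.fourier_dyadicDilate, ← hF, finrank_euclideanSpace_fin]
    have : ⇑((((2 : ℝ) ^ (n - 1)) ^ d)⁻¹ •
        SchwartzMap.dyadicDilate (-(n - 1)) F) = (((2 : ℝ) ^ (n - 1)) ^ d)⁻¹ •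
        ⇑(SchwartzMap.dyadicDilate (-(n - 1)) F) := by
      ext x; rfl
    rw [this, eLpNorm_const_smul, SchwartzMap.eLpNorm_dyadicDilate, finrank_euclideanSpace_fin,
      hqp, Real.enorm_of_nonneg h4.le, ← mul_assoc, ← ENNReal.ofReal_mul h4.le]
    congr 2
    rw [← zpow_natCast, ← zpow_mul, ← zpow_neg, ← Real.rpow_intCast, ← Real.rpow_add two_pos]
    congr 1
    push_cast
    ring
  have h5 : eLpNorm F q volume ≠ ∞ :=
    (F.eLpNorm_lt_top q volume).ne
  rw [h3] at h2
  rw [h1]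
  have h6 := ENNReal.toReal_mono (ENNReal.mul_ne_top hf
    (ENNReal.mul_ne_top ENNReal.ofReal_ne_top h5)) h2
  rw [toReal_enorm, ENNReal.toReal_mul, ENNReal.toReal_mul,
    ENNReal.toReal_ofReal (by positivity)] at h6
  refine h6.trans (le_of_eq ?_)
  have h7 : (2 : ℝ) ^ (-(((n : ℝ) - 1) * (d * (p⁻¹).toReal))) =
      2 ^ ((d : ℝ) * (p⁻¹).toReal) * 2 ^ (-((n : ℝ) * (d * (p⁻¹).toReal))) := by
    rw [← Real.rpow_add two_pos]
    congr 1
    ring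
  rw [h7]
  ring

variable {χ}

/-- For `n ≥ 0` the contracted shell stays where `χ = 1`, so the pairing is the integral of the
Fourier transform, that is, the value at the origin, which dilation preserves. -/
theorem IsAnnular.fourier_dyadicDilate_apply_schwartz {ψ : 𝓢(EuclideanSpace ℝ (Fin d), ℂ)}
    (h : χ.IsAnnular ψ) {n : ℤ} (hn : 0 ≤ n) :
    𝓕 (SchwartzMap.toTemperedDistributionCLM _ ℂ volume (SchwartzMap.dyadicDilate (-n) ψ))
      χ.schwartz = ψ 0 := by
  rw [TemperedDistribution.fourier_toTemperedDistributionCLM_eq]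
  refine (SchwartzMap.toTemperedDistributionCLM_apply_apply volume _ _).trans ?_
  have h1 : ∀ ξ, χ.schwartz ξ • 𝓕 (SchwartzMap.dyadicDilate (-n) ψ) ξ =
      𝓕 (SchwartzMap.dyadicDilate (-n) ψ) ξ := by
    intro ξ
    rw [SchwartzMap.fourier_dyadicDilate, smul_apply, SchwartzMap.dyadicDilate_apply,
      neg_neg, schwartz_apply]
    by_cases h0 : 𝓕 ψ ((2 : ℝ) ^ n • ξ) = 0
    · simp [h0]
    · rw [(h _ h0).2 ξ, Complex.ofReal_one, one_smul]
      rw [norm_smul, norm_zpow, Real.norm_two]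
      exact le_mul_of_one_le_left (norm_nonneg _) (one_le_zpow₀ (by norm_num) hn)
  simp_rw [h1]
  have h2 : 𝓕⁻ (𝓕 (SchwartzMap.dyadicDilate (-n) ψ)) (0 : EuclideanSpace ℝ (Fin d)) =
      ∫ x, 𝓕 (SchwartzMap.dyadicDilate (-n) ψ) x := by
    rw [SchwartzMap.fourierInv_coe, Real.fourierInv_eq]
    simp
  rw [← h2, FourierTransform.fourierInv_fourier_eq, SchwartzMap.dyadicDilate_apply, smul_zero]

end LPCutoff

/-! ### Sums of low-frequency bumps, modulo polynomials -/

section lowFrequency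

variable {d : ℕ}

theorem MvPolynomial.exists_eval_smul (P : MvPolynomial (Fin d) ℂ) (c : ℝ) :
    ∃ Q : MvPolynomial (Fin d) ℂ, ∀ x : EuclideanSpace ℝ (Fin d),
      MvPolynomial.eval (fun i => (x i : ℂ)) Q =
        MvPolynomial.eval (fun i => ((c • x) i : ℂ)) P := by
  refine ⟨MvPolynomial.bind₁ (fun i => MvPolynomial.C (c : ℂ) * MvPolynomial.X i) P, fun x => ?_⟩
  induction P using MvPolynomial.induction_on with
  | C a => simp
  | add p q hp hq => simp only [map_add, hp, hq]
  | mul_X p i hp => simp [map_mul, hp]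

theorem hasTemperateGrowth_one_add_norm_sq_pow (M : ℕ) : Function.HasTemperateGrowth
    (fun x : EuclideanSpace ℝ (Fin d) => (((1 + ‖x‖ ^ 2) ^ M : ℝ) : ℂ)) := by
  have h1 := (Function.HasTemperateGrowth.const (E := EuclideanSpace ℝ (Fin d)) (1 : ℝ)).add
    (Function.hasTemperateGrowth_norm_sq (H := EuclideanSpace ℝ (Fin d)))
  have h2 := h1.pow M
  fun_prop

/-- Up to a weight of temperate growth, the dilates `ψ(2^(-n) x)` minus suitable polynomials are
bounded functions whose norm decays faster than `2^(-nσ)`. -/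
theorem exists_weighted_dilates (ψ : 𝓢(EuclideanSpace ℝ (Fin d), ℂ)) (σ : ℝ) :
    ∃ (Φ : Lp ℂ ∞ (volume : Measure (EuclideanSpace ℝ (Fin d))) →L[ℂ]
        𝓢'(EuclideanSpace ℝ (Fin d), ℂ))
      (w : ℕ → Lp ℂ ∞ (volume : Measure (EuclideanSpace ℝ (Fin d))))
      (P : ℕ → MvPolynomial (Fin d) ℂ),
      (Summable fun n : ℕ => (2 : ℝ) ^ ((n : ℝ) * σ) * ‖w n‖) ∧
      ∀ n : ℕ, Φ (w n) = SchwartzMap.toTemperedDistributionCLM _ ℂ volume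
        (SchwartzMap.dyadicDilate (-(n : ℤ)) ψ) - polyDistribution d (P n) := by
  -- Taylor order `2 * M > σ` makes the series geometric with ratio `2^(σ - 2M) < 1`; an even order
  -- allows the smooth weight `(1 + ‖x‖^2)^M`.
  obtain ⟨M, hM⟩ := exists_nat_gt σ
  obtain ⟨P, C, hC, hP⟩ := ψ.exists_mvPolynomial_norm_sub_le (2 * M)
  choose Q hQ using fun n : ℕ => P.exists_eval_smul ((2 : ℝ) ^ (-(n : ℤ)))
  let W : EuclideanSpace ℝ (Fin d) → ℝ := fun x => (1 + ‖x‖ ^ 2) ^ M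
  have hW : ∀ x, 0 < W x := fun x => by positivity
  have hWt : Function.HasTemperateGrowth (fun x => (W x : ℂ)) :=
    hasTemperateGrowth_one_add_norm_sq_pow M
  let r : ℕ → EuclideanSpace ℝ (Fin d) → ℂ := fun n x =>
    ψ ((2 : ℝ) ^ (-(n : ℤ)) • x) - MvPolynomial.eval (fun i => (x i : ℂ)) (Q n)
  have hrc : ∀ n, Continuous (r n) := fun n =>
    (ψ.continuous.comp (continuous_const_smul _)).sub
      (polyFun_hasTemperateGrowth (Q n)).1.continuous
  have hr : ∀ n x, ‖(W x : ℂ)⁻¹ * r n x‖ ≤ C * ((2 : ℝ) ^ (-(n : ℤ))) ^ (2 * M) := fun n x => by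
    have h1 := hP ((2 : ℝ) ^ (-(n : ℤ)) • x)
    rw [← hQ, norm_smul, norm_zpow, Real.norm_two, mul_pow] at h1
    have h2 : ‖x‖ ^ (2 * M) ≤ W x := by
      rw [pow_mul]
      exact pow_le_pow_left₀ (by positivity) (by linarith) M
    rw [norm_mul, norm_inv, Complex.norm_real, Real.norm_of_nonneg (hW x).le,
      inv_mul_le_iff₀ (hW x)]
    refine h1.trans ?_
    calc C * (((2 : ℝ) ^ (-(n : ℤ))) ^ (2 * M) * ‖x‖ ^ (2 * M))
        ≤ C * (((2 : ℝ) ^ (-(n : ℤ))) ^ (2 * M) * W x) := by gcongr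
      _ = _ := by ring
  have hm : ∀ n, MemLp (fun x => (W x : ℂ)⁻¹ * r n x) ∞ volume := fun n =>
    memLp_top_of_bound (((hWt.1.continuous.inv₀ fun x => by
      exact_mod_cast (hW x).ne').mul (hrc n)).aestronglyMeasurable) _ (Eventually.of_forall (hr n))
  -- `Φ` restores the weight. Summation can thus be done absolutely in the Banach space `L^∞` and
  -- transported to `𝓢'` by continuity.
  refine ⟨(TemperedDistribution.smulLeftCLM ℂ fun x => (W x : ℂ)).comp
    (Lp.toTemperedDistributionCLM ℂ volume ∞), fun n => (hm n).toLp _, Q, ?_, fun n => ?_⟩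
  · have hb : ∀ n, ‖(hm n).toLp _‖ ≤ C * ((2 : ℝ) ^ (-(n : ℤ))) ^ (2 * M) := fun n => by
      rw [Lp.norm_toLp, eLpNorm_exponent_top]
      refine ENNReal.toReal_le_of_le_ofReal (by positivity) ?_
      exact eLpNormEssSup_le_of_ae_bound (Eventually.of_forall (hr n))
    have hg : Summable fun n : ℕ => C * ((2 : ℝ) ^ (σ - 2 * M)) ^ n := by
      refine (summable_geometric_of_lt_one (by positivity) ?_).mul_left C
      refine Real.rpow_lt_one_of_one_lt_of_neg one_lt_two ?_
      have : (0 : ℝ) ≤ M := by positivity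
      linarith
    refine Summable.of_nonneg_of_le (fun n => by positivity) (fun n => ?_) hg
    calc (2 : ℝ) ^ ((n : ℝ) * σ) * ‖(hm n).toLp _‖
        ≤ 2 ^ ((n : ℝ) * σ) * (C * ((2 : ℝ) ^ (-(n : ℤ))) ^ (2 * M)) := by
          gcongr
          exact hb n
      _ = C * ((2 : ℝ) ^ ((n : ℝ) * σ) * ((2 : ℝ) ^ (-(n : ℤ))) ^ (2 * M)) := by ring
      _ = _ := by
          congr 1
          rw [← Real.rpow_intCast, ← Real.rpow_natCast, ← Real.rpow_mul two_pos.le,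
            ← Real.rpow_add two_pos, ← Real.rpow_natCast, ← Real.rpow_mul two_pos.le]
          congr 1
          push_cast
          ring
  · ext g
    change Lp.toTemperedDistribution ((hm n).toLp _)
      (SchwartzMap.smulLeftCLM ℂ (fun x => (W x : ℂ)) g) =
      SchwartzMap.toTemperedDistributionCLM _ ℂ volume
        (SchwartzMap.dyadicDilate (-(n : ℤ)) ψ) g - polyDistribution d (Q n) g
    rw [Lp.toTemperedDistribution_apply, polyDistribution_apply,
      SchwartzMap.toTemperedDistributionCLM_apply_apply volume, ← integral_sub]
    · refine integral_congr_ae ?_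
      filter_upwards [(hm n).coeFn_toLp] with x hx
      have : (W x : ℂ) ≠ 0 := by exact_mod_cast (hW x).ne'
      rw [hx, SchwartzMap.smulLeftCLM_apply_apply hWt]
      simp only [r, SchwartzMap.dyadicDilate_apply, smul_eq_mul]
      field_simp
    · exact (SchwartzMap.pairing (ContinuousLinearMap.lsmul ℂ ℂ) g
        (SchwartzMap.dyadicDilate (-(n : ℤ)) ψ)).integrable
    · exact (SchwartzMap.bilinLeftCLM (ContinuousLinearMap.lsmul ℂ ℂ)
        (polyFun_hasTemperateGrowth (Q n)) g).integrable

/-- The sum of the bumps `u n 2^(nσ) ψ(2^(-n) x)`, each corrected by a polynomial. -/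
theorem exists_lowFrequencySum (ψ : 𝓢(EuclideanSpace ℝ (Fin d), ℂ)) (σ : ℝ) :
    ∃ (F : EllInfty →ₗ[ℂ] 𝓢'(EuclideanSpace ℝ (Fin d), ℂ)) (P : ℕ → MvPolynomial (Fin d) ℂ),
      ∀ u : EllInfty, HasSum (fun n : ℕ => (u n * ((2 : ℝ) ^ ((n : ℝ) * σ) : ℝ) : ℂ) •
        (SchwartzMap.toTemperedDistributionCLM _ ℂ volume
          (SchwartzMap.dyadicDilate (-(n : ℤ)) ψ) - polyDistribution d (P n))) (F u) := by
  obtain ⟨Φ, w, P, hw, hΦ⟩ := exists_weighted_dilates ψ σ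
  have hs : ∀ u : EllInfty,
      Summable fun n : ℕ => (u n * ((2 : ℝ) ^ ((n : ℝ) * σ) : ℝ) : ℂ) • w n := fun u => by
    refine Summable.of_norm_bounded (hw.mul_left ‖u‖) fun n => ?_
    rw [norm_smul, norm_mul, Complex.norm_real, Real.norm_of_nonneg (by positivity), mul_assoc]
    gcongr
    exact lp.norm_apply_le_norm ENNReal.top_ne_zero u n
  let S : EllInfty →ₗ[ℂ] Lp ℂ ∞ (volume : Measure (EuclideanSpace ℝ (Fin d))) :=
    { toFun := fun u => ∑' n : ℕ, (u n * ((2 : ℝ) ^ ((n : ℝ) * σ) : ℝ) : ℂ) • w n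
      map_add' := fun u v => by
        rw [← (hs u).tsum_add (hs v)]
        simp only [lp.coeFn_add, Pi.add_apply, add_mul, add_smul]
      map_smul' := fun c u => by
        rw [RingHom.id_apply, ← (hs u).tsum_const_smul c]
        simp only [lp.coeFn_smul, Pi.smul_apply, smul_eq_mul, mul_assoc, mul_smul] }
  refine ⟨Φ.toLinearMap.comp S, P, fun u => ?_⟩
  have := Φ.hasSum (hs u).hasSum
  simp only [map_smul, hΦ] at this
  exact this

end lowFrequency

/-! ### The embedding of bounded sequences -/

namespace LPCutoff

variable {d : ℕ} {χ : LPCutoff d} {ψ : 𝓢(EuclideanSpace ℝ (Fin d), ℂ)}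

theorem IsAnnular.hasSum_block (h : χ.IsAnnular ψ) {a : ℕ → ℂ} {P : ℕ → MvPolynomial (Fin d) ℂ}
    {T : 𝓢'(EuclideanSpace ℝ (Fin d), ℂ)}
    (hT : HasSum (fun n : ℕ => a n • (SchwartzMap.toTemperedDistributionCLM _ ℂ volume
      (SchwartzMap.dyadicDilate (-(n : ℤ)) ψ) - polyDistribution d (P n))) T) (m : ℤ) :
    HasSum (fun n : ℕ => if m = -(n : ℤ) then a n • SchwartzMap.toTemperedDistributionCLM _ ℂ volume
      (SchwartzMap.dyadicDilate (-(n : ℤ)) ψ) else 0) (χ.block m T) := by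
  refine ((χ.block m).hasSum hT).congr_fun fun n => ?_
  have h1 : χ.block m (polyDistribution d (P n)) = 0 :=
    χ.polySubmodule_le_ker_block m (LinearMap.mem_range_self _ (P n))
  rw [map_smul, map_sub, h1, h.block_dyadicDilate, sub_zero]
  split_ifs
  · rfl
  · exact (smul_zero (A := 𝓢'(EuclideanSpace ℝ (Fin d), ℂ)) (a n)).symm

theorem IsAnnular.block_neg (h : χ.IsAnnular ψ) {a : ℕ → ℂ} {P : ℕ → MvPolynomial (Fin d) ℂ}
    {T : 𝓢'(EuclideanSpace ℝ (Fin d), ℂ)}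
    (hT : HasSum (fun n : ℕ => a n • (SchwartzMap.toTemperedDistributionCLM _ ℂ volume
      (SchwartzMap.dyadicDilate (-(n : ℤ)) ψ) - polyDistribution d (P n))) T) (n : ℕ) :
    χ.block (-(n : ℤ)) T = a n • SchwartzMap.toTemperedDistributionCLM _ ℂ volume
      (SchwartzMap.dyadicDilate (-(n : ℤ)) ψ) := by
  refine (h.hasSum_block hT _).unique ?_
  convert hasSum_single (f := fun k : ℕ => if -(n : ℤ) = -(k : ℤ) then
    a k • SchwartzMap.toTemperedDistributionCLM _ ℂ volume
      (SchwartzMap.dyadicDilate (-(k : ℤ)) ψ) else 0) n ?_ using 1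
  · simp
  · intro k hk
    rw [if_neg]
    omega

theorem IsAnnular.block_pos (h : χ.IsAnnular ψ) {a : ℕ → ℂ} {P : ℕ → MvPolynomial (Fin d) ℂ}
    {T : 𝓢'(EuclideanSpace ℝ (Fin d), ℂ)}
    (hT : HasSum (fun n : ℕ => a n • (SchwartzMap.toTemperedDistributionCLM _ ℂ volume
      (SchwartzMap.dyadicDilate (-(n : ℤ)) ψ) - polyDistribution d (P n))) T) {m : ℤ} (hm : 0 < m) :
    χ.block m T = 0 := by
  refine (h.hasSum_block hT m).unique ?_
  convert hasSum_zero using 2 with k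
  rw [if_neg]
  omega

theorem IsAnnular.mkQ_eq_of_finite (h : χ.IsAnnular ψ) {a : ℕ → ℂ}
    {P : ℕ → MvPolynomial (Fin d) ℂ} {T : 𝓢'(EuclideanSpace ℝ (Fin d), ℂ)}
    (hT : HasSum (fun n : ℕ => a n • (SchwartzMap.toTemperedDistributionCLM _ ℂ volume
      (SchwartzMap.dyadicDilate (-(n : ℤ)) ψ) - polyDistribution d (P n))) T) {K : ℕ}
    (ha : ∀ n, K ≤ n → a n = 0) :
    (polySubmodule d).mkQ T ∈ χ.homDistributions.map (polySubmodule d).mkQ := by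
  have h1 := hT.unique (hasSum_sum_of_ne_finset_zero (s := Finset.range K) fun n hn => by
    rw [ha n (by simpa using hn), zero_smul])
  have h2 : ∀ n, (polySubmodule d).mkQ (polyDistribution d (P n)) = 0 := fun n =>
    (Submodule.Quotient.mk_eq_zero _).2 (LinearMap.mem_range_self _ (P n))
  rw [h1, map_sum]
  refine Submodule.sum_mem _ fun n _ => ?_
  rw [map_smul, map_sub, h2, sub_zero]
  exact Submodule.smul_mem _ _ (Submodule.mem_map_of_mem (h.dyadicDilate_mem_homDistributions _))

end LPCutoff

theorem SchwartzMap.eLpNorm_ne_zero {d : ℕ} {ψ : 𝓢(EuclideanSpace ℝ (Fin d), ℂ)} (hψ : ψ ≠ 0)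
    {p : ℝ≥0∞} (hp : p ≠ 0) : eLpNorm ψ p volume ≠ 0 := by
  intro h
  rw [eLpNorm_eq_zero_iff ψ.continuous.aestronglyMeasurable hp] at h
  have := (Continuous.ae_eq_iff_eq volume ψ.continuous continuous_const).1 h
  exact hψ (SchwartzMap.ext fun x => congrFun this x)

section embedding

variable {d : ℕ} {χ : LPCutoff d} {s : ℝ} {p : ℝ≥0∞} [Fact (1 ≤ p)]

theorem HomBesov.weight_mul_lpENorm_le (f : HomBesov χ s p) (m : ℤ) :
    ENNReal.ofReal ((2 : ℝ) ^ ((m : ℝ) * s)) * lpENorm p (HomBesov.block χ s p m f) ≤ ‖f‖ₑ := by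
  have : ‖f‖ₑ = besovENorm χ s p (HomBesov.toQuotient χ s p f) := by
    rw [← ofReal_norm, HomBesov.norm_def,
      ENNReal.ofReal_toReal (HomBesov.besovENorm_ne_top χ s p f)]
  rw [this]
  exact le_iSup (fun m : ℤ => ENNReal.ofReal ((2 : ℝ) ^ ((m : ℝ) * s)) *
    lpENorm p (χ.blockMod m (HomBesov.toQuotient χ s p f))) m

/-- The exponents `-ns`, `n(s - d/p)` and `nd/p` add up to zero: this is the reason for the
normalization of the bumps. -/
theorem weight_mul_lpENorm_bump (ψ : 𝓢(EuclideanSpace ℝ (Fin d), ℂ)) (n : ℕ) (c : ℂ) :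
    ENNReal.ofReal ((2 : ℝ) ^ (((-(n : ℤ) : ℤ) : ℝ) * s)) *
      lpENorm p ((c * ((2 : ℝ) ^ ((n : ℝ) * (s - d * (p⁻¹).toReal)) : ℝ) : ℂ) •
        SchwartzMap.toTemperedDistributionCLM _ ℂ volume
          (SchwartzMap.dyadicDilate (-(n : ℤ)) ψ)) = ‖c‖ₑ * eLpNorm ψ p volume := by
  rw [lpENorm_smul, lpENorm_schwartz, SchwartzMap.eLpNorm_dyadicDilate, enorm_mul,
    finrank_euclideanSpace_fin]
  have h1 : ‖(((2 : ℝ) ^ ((n : ℝ) * (s - d * (p⁻¹).toReal)) : ℝ) : ℂ)‖ₑ =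
      ENNReal.ofReal ((2 : ℝ) ^ ((n : ℝ) * (s - d * (p⁻¹).toReal))) := by
    rw [← ofReal_norm, Complex.norm_real, Real.norm_of_nonneg (by positivity)]
  have h2 : ENNReal.ofReal ((2 : ℝ) ^ (((-(n : ℤ) : ℤ) : ℝ) * s)) *
      (ENNReal.ofReal ((2 : ℝ) ^ ((n : ℝ) * (s - d * (p⁻¹).toReal))) *
      ENNReal.ofReal ((2 : ℝ) ^ (-(((-(n : ℤ) : ℤ) : ℝ) * (d * (p⁻¹).toReal))))) = 1 := by
    rw [← ENNReal.ofReal_mul (by positivity), ← ENNReal.ofReal_mul (by positivity),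
      ← Real.rpow_add two_pos, ← Real.rpow_add two_pos, ← ENNReal.ofReal_one]
    congr 1
    rw [← Real.rpow_zero (2 : ℝ)]
    congr 1
    push_cast
    ring
  rw [h1]
  calc _ = ENNReal.ofReal ((2 : ℝ) ^ (((-(n : ℤ) : ℤ) : ℝ) * s)) *
      (ENNReal.ofReal ((2 : ℝ) ^ ((n : ℝ) * (s - d * (p⁻¹).toReal))) *
      ENNReal.ofReal ((2 : ℝ) ^ (-(((-(n : ℤ) : ℤ) : ℝ) * (d * (p⁻¹).toReal))))) *
      (‖c‖ₑ * eLpNorm ψ p volume) := by ring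
    _ = _ := by rw [h2, one_mul]

/-- The map `u ↦ ∑ u n 2^(n(s - d/p)) ψ(2^(-n) x)` from bounded sequences to the Besov space. -/
theorem LPCutoff.IsAnnular.exists_embedding {ψ : 𝓢(EuclideanSpace ℝ (Fin d), ℂ)}
    (h : χ.IsAnnular ψ) :
    ∃ J : EllInfty →L[ℂ] HomBesov χ s p,
      (∀ (u : EllInfty) (n : ℕ), HomBesov.block χ s p (-(n : ℤ)) (J u) =
        (u n * ((2 : ℝ) ^ ((n : ℝ) * (s - d * (p⁻¹).toReal)) : ℝ) : ℂ) •
          SchwartzMap.toTemperedDistributionCLM _ ℂ volume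
            (SchwartzMap.dyadicDilate (-(n : ℤ)) ψ)) ∧
      (∀ u m, 0 < m → HomBesov.block χ s p m (J u) = 0) ∧
      (∀ (u : EllInfty) (K : ℕ), (∀ n, K ≤ n → u n = 0) → J u ∈ closureHom χ s p) ∧
      ∀ u, ‖J u‖ = (eLpNorm ψ p volume).toReal * ‖u‖ := by
  obtain ⟨F, P, hF⟩ := exists_lowFrequencySum ψ (s - d * (p⁻¹).toReal)
  have hA : eLpNorm ψ p volume ≠ ∞ := (ψ.eLpNorm_lt_top p volume).ne
  have hle : ∀ u, besovENorm χ s p ((polySubmodule d).mkQ (F u)) ≤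
      ENNReal.ofReal ((eLpNorm ψ p volume).toReal * ‖u‖) := fun u => by
    refine iSup_le fun m => ?_
    change _ * lpENorm p (χ.block m (F u)) ≤ _
    rcases lt_or_ge 0 m with hm | hm
    · rw [h.block_pos (hF u) hm, lpENorm_zero, mul_zero]
      exact zero_le
    · obtain ⟨n, rfl⟩ : ∃ n : ℕ, m = -(n : ℤ) := ⟨(-m).toNat, by omega⟩
      rw [h.block_neg (hF u), weight_mul_lpENorm_bump, mul_comm,
        ENNReal.ofReal_mul ENNReal.toReal_nonneg, ENNReal.ofReal_toReal hA, ← ofReal_norm]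
      gcongr
      exact lp.norm_apply_le_norm ENNReal.top_ne_zero u n
  let J₀ : EllInfty →ₗ[ℂ] HomBesov χ s p :=
    LinearMap.codRestrict (besovSubmodule χ s p) ((polySubmodule d).mkQ.comp F)
      fun u => (hle u).trans_lt ENNReal.ofReal_lt_top
  have hJ₀ : ∀ u, HomBesov.toQuotient χ s p (J₀ u) = (polySubmodule d).mkQ (F u) := fun u => rfl
  have hb : ∀ u m, HomBesov.block χ s p m (J₀ u) = χ.block m (F u) := fun u m => rfl
  have hn : ∀ u, ‖J₀ u‖ ≤ (eLpNorm ψ p volume).toReal * ‖u‖ := fun u => by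
    rw [HomBesov.norm_def, hJ₀]
    exact ENNReal.toReal_le_of_le_ofReal (by positivity) (hle u)
  refine ⟨J₀.mkContinuous _ hn, fun u n => ?_, fun u m hm => ?_, fun u K hK => ?_, fun u => ?_⟩
  · exact (hb u _).trans (h.block_neg (hF u) n)
  · exact (hb u _).trans (h.block_pos (hF u) hm)
  · refine Submodule.le_topologicalClosure _ ?_
    exact h.mkQ_eq_of_finite (hF u) (K := K) fun n hn => by rw [hK n hn, zero_mul]
  · refine le_antisymm (hn u) ?_
    rcases eq_or_ne (eLpNorm ψ p volume) 0 with h0 | h0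
    · simp [h0]
    have hA0 : 0 < (eLpNorm ψ p volume).toReal := ENNReal.toReal_pos h0 hA
    rw [← le_div_iff₀' hA0]
    -- The block `-n` alone already detects `‖u n‖` times the `L^p` norm of `ψ`.
    refine lp.norm_le_of_forall_le (by positivity) fun n => ?_
    rw [le_div_iff₀ hA0]
    have h1 := HomBesov.weight_mul_lpENorm_le (J₀ u) (-(n : ℤ))
    rw [hb, h.block_neg (hF u), weight_mul_lpENorm_bump] at h1
    have h2 := ENNReal.toReal_mono enorm_ne_top h1
    rwa [ENNReal.toReal_mul, toReal_enorm, toReal_enorm] at h2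

/-- The low-frequency parts of the elements of `S'_h` are negligible: distances to `S'_h` control
the limsup of the coefficients of low-frequency bumps. -/
theorem LPCutoff.IsAnnular.exists_coeff_le (hs : (d : ℝ) * (p⁻¹).toReal ≤ s)
    {ψ : 𝓢(EuclideanSpace ℝ (Fin d), ℂ)} (h : χ.IsAnnular ψ) (hψ : ψ 0 ≠ 0) :
    ∃ C : ℝ, 0 < C ∧ ∀ (f z : HomBesov χ s p) (u : ℕ → ℂ),
      (∀ n : ℕ, HomBesov.block χ s p (-(n : ℤ)) f =
        (u n * ((2 : ℝ) ^ ((n : ℝ) * (s - d * (p⁻¹).toReal)) : ℝ) : ℂ) •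
          SchwartzMap.toTemperedDistributionCLM _ ℂ volume
            (SchwartzMap.dyadicDilate (-(n : ℤ)) ψ)) →
      z ∈ closureHom χ s p → ∀ δ > 0, ∀ᶠ n in atTop, ‖u n‖ ≤ C * ‖f - z‖ + δ := by
  obtain ⟨C, hC, hbound⟩ := χ.exists_norm_fourier_block_apply_le p
  have hψ' : 0 < ‖ψ 0‖ := norm_pos_iff.2 hψ
  -- The estimate is first proved for `g` with a representative in `S'_h`; the closure is reached by
  -- approximation at the end.
  have key : ∀ (f g : HomBesov χ s p) (u : ℕ → ℂ),
      (∀ n : ℕ, HomBesov.block χ s p (-(n : ℤ)) f =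
        (u n * ((2 : ℝ) ^ ((n : ℝ) * (s - d * (p⁻¹).toReal)) : ℝ) : ℂ) •
          SchwartzMap.toTemperedDistributionCLM _ ℂ volume
            (SchwartzMap.dyadicDilate (-(n : ℤ)) ψ)) →
      g ∈ (χ.homDistributions.map (polySubmodule d).mkQ).comap (HomBesov.toQuotient χ s p) →
      ∀ δ > 0, ∀ᶠ n in atTop, ‖u n‖ * ‖ψ 0‖ ≤ C * ‖f - g‖ + δ := by
    rintro f g u hf ⟨T, hT, hTg⟩ δ hδ
    have ht := (χ.tendsto_fourier_block_apply hT χ.schwartz).norm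
    rw [norm_zero] at ht
    filter_upwards [ht.eventually (gt_mem_nhds hδ), eventually_ge_atTop 1] with n hn hn1
    set W : ℝ := (2 : ℝ) ^ ((n : ℝ) * (s - d * (p⁻¹).toReal)) with hW
    -- Here `s ≥ d/p` enters: the error `δ` from the `S'_h` part survives division by `W`.
    have hW1 : 1 ≤ W := Real.one_le_rpow one_le_two (mul_nonneg (by positivity) (by linarith))
    have hg : HomBesov.block χ s p (-(n : ℤ)) g = χ.block (-(n : ℤ)) T := by
      rw [HomBesov.block, ← hTg]
      rfl
    obtain ⟨D, hD⟩ := (polySubmodule d).mkQ_surjective (HomBesov.toQuotient χ s p (f - g))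
    have hDb : χ.block (-(n : ℤ)) D = HomBesov.block χ s p (-(n : ℤ)) (f - g) := by
      rw [HomBesov.block, ← hD]
      rfl
    have hsub : HomBesov.block χ s p (-(n : ℤ)) (f - g) =
        HomBesov.block χ s p (-(n : ℤ)) f - HomBesov.block χ s p (-(n : ℤ)) g := by
      simp only [HomBesov.block, map_sub]
    have h1 := HomBesov.weight_mul_lpENorm_le (f - g) (-(n : ℤ))
    have hw : (0 : ℝ) < (2 : ℝ) ^ (((-(n : ℤ) : ℤ) : ℝ) * s) := by positivity
    have hfin : lpENorm p (χ.block (-(n : ℤ)) D) ≠ ∞ := by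
      intro htop
      rw [← hDb, htop, ENNReal.mul_top (by simpa using hw)] at h1
      exact enorm_ne_top (top_le_iff.1 h1)
    have h2 := ENNReal.toReal_mono enorm_ne_top h1
    rw [toReal_enorm, ENNReal.toReal_mul, ENNReal.toReal_ofReal hw.le, ← hDb] at h2
    have h3 := hbound D n (by exact_mod_cast hn1) hfin
    have h4 : 𝓕 (χ.block (-(n : ℤ)) D) χ.schwartz =
        u n * W * ψ 0 - 𝓕 (χ.block (-(n : ℤ)) T) χ.schwartz := by
      rw [hDb, hsub, hf, hg]
      have h5 := h.fourier_dyadicDilate_apply_schwartz (n := n) (by positivity)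
      rw [← h5]
      rfl
    have h6 : ‖u n‖ * ‖ψ 0‖ * W ≤ ‖𝓕 (χ.block (-(n : ℤ)) D) χ.schwartz‖ + δ := by
      have h7 : ‖u n * W * ψ 0‖ = ‖u n‖ * ‖ψ 0‖ * W := by
        rw [norm_mul, norm_mul, Complex.norm_real, Real.norm_of_nonneg (by linarith)]
        ring
      rw [← h7, h4]
      have := norm_sub_norm_le (u n * W * ψ 0) (𝓕 (χ.block (-(n : ℤ)) T) χ.schwartz)
      linarith
    have h8 : C * 2 ^ (-(((n : ℤ) : ℝ) * (d * (p⁻¹).toReal))) *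
        (lpENorm p (χ.block (-(n : ℤ)) D)).toReal ≤ C * ‖f - g‖ * W := by
      have h9 : (2 : ℝ) ^ (-(((n : ℤ) : ℝ) * (d * (p⁻¹).toReal))) =
          W * (2 : ℝ) ^ (((-(n : ℤ) : ℤ) : ℝ) * s) := by
        rw [hW, ← Real.rpow_add two_pos]
        congr 1
        push_cast
        ring
      rw [h9]
      calc _ = C * W * ((2 : ℝ) ^ (((-(n : ℤ) : ℤ) : ℝ) * s) *
            (lpENorm p (χ.block (-(n : ℤ)) D)).toReal) := by ring
        _ ≤ C * W * ‖f - g‖ := by gcongr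
        _ = _ := by ring
    have h10 : ‖u n‖ * ‖ψ 0‖ * W ≤ (C * ‖f - g‖ + δ) * W := by
      have : δ ≤ δ * W := le_mul_of_one_le_right hδ.le hW1
      linarith
    exact le_of_mul_le_mul_right h10 (by linarith)
  -- `C + 1` rather than `C`, which may be zero, since the constant must be positive and the
  -- tolerance below divides by it.
  refine ⟨(C + 1) / ‖ψ 0‖, by positivity, fun f z u hf hz δ hδ => ?_⟩
  obtain ⟨g, hg, hgz⟩ := Metric.mem_closure_iff.1 hz (δ * ‖ψ 0‖ / (2 * (C + 1))) (by positivity)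
  filter_upwards [key f g u hf hg (δ * ‖ψ 0‖ / 2) (by positivity)] with n hn
  have h1 : ‖f - g‖ ≤ ‖f - z‖ + δ * ‖ψ 0‖ / (2 * (C + 1)) := by
    have := norm_sub_le_norm_sub_add_norm_sub f z g
    rw [dist_eq_norm] at hgz
    linarith
  rw [← mul_le_mul_iff_left₀ hψ']
  calc ‖u n‖ * ‖ψ 0‖ ≤ C * ‖f - g‖ + δ * ‖ψ 0‖ / 2 := hn
    _ ≤ (C + 1) * (‖f - z‖ + δ * ‖ψ 0‖ / (2 * (C + 1))) + δ * ‖ψ 0‖ / 2 := by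
        gcongr
        linarith
    _ = _ := by
        field_simp
        ring

end embedding

/-! ### Bounded sequences modulo null sequences -/

section sequences

/-- The sequence `u` with the terms of index at least `K` replaced by zero. -/
noncomputable def EllInfty.truncate (u : EllInfty) (K : ℕ) : EllInfty :=
  ⟨fun n => if n < K then u n else 0, memℓp_infty ⟨‖u‖, by
    rintro _ ⟨n, rfl⟩
    dsimp only
    split_ifs
    · exact lp.norm_apply_le_norm ENNReal.top_ne_zero u n
    · simp⟩⟩

theorem EllInfty.truncate_apply (u : EllInfty) (K n : ℕ) :
    u.truncate K n = if n < K then u n else 0 := rfl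

theorem EllInfty.norm_sub_truncate_le (u : EllInfty) {K : ℕ} {L : ℝ} (hL : 0 ≤ L)
    (h : ∀ n, K ≤ n → ‖u n‖ ≤ L) : ‖u - u.truncate K‖ ≤ L := by
  refine lp.norm_le_of_forall_le hL fun n => ?_
  rw [lp.coeFn_sub, Pi.sub_apply, EllInfty.truncate_apply]
  split_ifs with hn
  · simpa using hL
  · simpa using h n (not_lt.1 hn)

theorem EllInfty.truncate_mem_cZero (u : EllInfty) (K : ℕ) : u.truncate K ∈ cZero := by
  refine tendsto_const_nhds.congr' ?_
  filter_upwards [eventually_ge_atTop K] with n hn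
  rw [EllInfty.truncate_apply, if_neg (not_lt.2 hn)]

/-- A truncation lies in `c₀`, so finitely many terms may be discarded. With the next lemma this
identifies the quotient norm with the limsup of `‖u n‖`. -/
theorem EllInfty.norm_mk_le_of_eventually_le (u : EllInfty) {L : ℝ} (hL : 0 ≤ L)
    (h : ∀ᶠ n in atTop, ‖u n‖ ≤ L) : ‖(Submodule.Quotient.mk u : EllInfty ⧸ cZero)‖ ≤ L := by
  obtain ⟨K, hK⟩ := eventually_atTop.1 h
  have h1 : (Submodule.Quotient.mk u : EllInfty ⧸ cZero) =
      Submodule.Quotient.mk (u - u.truncate K) := by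
    rw [Submodule.Quotient.eq]
    simpa using u.truncate_mem_cZero K
  rw [h1]
  exact (Submodule.Quotient.norm_mk_le _ _).trans (u.norm_sub_truncate_le hL hK)

theorem EllInfty.le_norm_mk_of_frequently_le (u : EllInfty) {L : ℝ}
    (h : ∃ᶠ n in atTop, L ≤ ‖u n‖) : L ≤ ‖(Submodule.Quotient.mk u : EllInfty ⧸ cZero)‖ := by
  refine le_of_forall_pos_le_add fun ε hε => ?_
  obtain ⟨v, hv, hvn⟩ := Submodule.Quotient.norm_mk_lt
    (Submodule.Quotient.mk u : EllInfty ⧸ cZero) (half_pos hε)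
  have hc : v - u ∈ cZero := (Submodule.Quotient.eq _).1 hv
  have hc' : Tendsto (fun n => ‖(v - u) n‖) atTop (𝓝 0) := by
    simpa using Tendsto.norm (show Tendsto (fun n => (v - u) n) atTop (𝓝 0) from hc)
  obtain ⟨n, hn, hn'⟩ := (h.and_eventually (hc'.eventually (gt_mem_nhds (half_pos hε)))).exists
  have h1 := lp.norm_apply_le_norm ENNReal.top_ne_zero v n
  rw [lp.coeFn_sub, Pi.sub_apply] at hn'
  have h2 := norm_sub_norm_le (u n) (v n)
  rw [norm_sub_rev] at h2
  linarith

/-- The bounded sequence in which each term of a binary sequence occurs infinitely often. -/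
noncomputable def EllInfty.ofBinary (x : ℕ → Bool) : EllInfty :=
  ⟨fun n => if x (Nat.unpair n).1 then 1 else 0, memℓp_infty ⟨1, by
    rintro _ ⟨n, rfl⟩
    dsimp only
    split_ifs <;> simp⟩⟩

theorem EllInfty.one_le_norm_mk_ofBinary_sub {x y : ℕ → Bool} (h : x ≠ y) :
    1 ≤ ‖(Submodule.Quotient.mk (EllInfty.ofBinary x) : EllInfty ⧸ cZero) -
      Submodule.Quotient.mk (EllInfty.ofBinary y)‖ := by
  rw [← Submodule.Quotient.mk_sub]
  apply EllInfty.le_norm_mk_of_frequently_le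
  obtain ⟨k, hk⟩ := Function.ne_iff.1 h
  -- The indices `Nat.pair k N` all decode to the differing digit `k` and are at least `N`.
  refine frequently_atTop.2 fun N => ⟨Nat.pair k N, Nat.right_le_pair k N, ?_⟩
  have : (EllInfty.ofBinary x - EllInfty.ofBinary y) (Nat.pair k N) =
      (if x k then (1 : ℂ) else 0) - (if y k then 1 else 0) := by
    rw [lp.coeFn_sub, Pi.sub_apply]
    simp [EllInfty.ofBinary]
  rw [this]
  cases hx : x k <;> cases hy : y k <;> simp_all

/-- The balls of radius `a / 2` are disjoint, so separability would make the set of binary sequences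
countable, against Cantor's diagonal argument. -/
theorem not_separableSpace_of_separated {X : Type*} [PseudoMetricSpace X] (f : (ℕ → Bool) → X)
    {a : ℝ} (ha : 0 < a) (h : ∀ x y, x ≠ y → a ≤ dist (f x) (f y)) :
    ¬ TopologicalSpace.SeparableSpace X := by
  intro hsep
  have hc : (Set.univ : Set (ℕ → Bool)).Countable :=
    Set.PairwiseDisjoint.countable_of_isOpen (s := fun x => Metric.ball (f x) (a / 2))
      (fun x _ y _ hxy => Metric.ball_disjoint_ball (by linarith [h x y hxy]))
      (fun _ _ => Metric.isOpen_ball) (fun x _ => ⟨f x, Metric.mem_ball_self (half_pos ha)⟩)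
  have := Set.countable_univ_iff.1 hc
  obtain ⟨g, hg⟩ := exists_surjective_nat (ℕ → Bool)
  obtain ⟨n, hn⟩ := hg fun k => !(g k k)
  simpa using congrFun hn n

end sequences

/-! ### Induced maps between quotients, and the main theorem -/

theorem Submodule.norm_mapQ_mk_le {𝕜 E F : Type*} [NormedField 𝕜] [SeminormedAddCommGroup E]
    [NormedSpace 𝕜 E] [SeminormedAddCommGroup F] [NormedSpace 𝕜 F] {S : Submodule 𝕜 E}
    {T : Submodule 𝕜 F} (J : E →ₗ[𝕜] F) (hJ : S ≤ T.comap J) {b : ℝ} (hb : 0 ≤ b)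
    (h : ∀ u, ‖J u‖ ≤ b * ‖u‖) (v : E ⧸ S) : ‖Submodule.mapQ S T J hJ v‖ ≤ b * ‖v‖ := by
  refine le_of_forall_pos_le_add fun ε hε => ?_
  obtain ⟨u, rfl, hu⟩ := Submodule.Quotient.norm_mk_lt v (ε := ε / (b + 1)) (by positivity)
  rw [Submodule.mapQ_apply]
  refine (Submodule.Quotient.norm_mk_le T (J u)).trans ((h u).trans ?_)
  calc b * ‖u‖ ≤ b * (‖(Submodule.Quotient.mk u : E ⧸ S)‖ + ε / (b + 1)) := by gcongr
    _ = b * ‖(Submodule.Quotient.mk u : E ⧸ S)‖ + b / (b + 1) * ε := by ring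
    _ ≤ _ := by
      gcongr
      refine mul_le_of_le_one_left hε.le ?_
      rw [div_le_one (by positivity)]
      linarith

theorem theoremt (d : ℕ) (hd : 0 < d) (χ : LPCutoff d) (p : ℝ≥0∞) [Fact (1 ≤ p)] (s : ℝ)
    (hs : (d : ℝ) * (p⁻¹).toReal ≤ s) :
    ¬ TopologicalSpace.SeparableSpace (HomBesov χ s p ⧸ closureHom χ s p) ∧
    ¬ TopologicalSpace.SeparableSpace (EllInfty ⧸ cZero) ∧
    ∃ (ψ : 𝓢(EuclideanSpace ℝ (Fin d), ℂ)) (J : EllInfty →L[ℂ] HomBesov χ s p)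
      (hJ : cZero ≤ (closureHom χ s p).comap J.toLinearMap),
      -- `ψ` is a nonzero bump with nonnegative Fourier transform on which `φ = 1`
      (ψ ≠ 0 ∧ (∀ ξ, ∃ r : ℝ, 0 ≤ r ∧ 𝓕 ψ ξ = (r : ℂ)) ∧
        ∀ ξ, (χ.annulus ξ : ℂ) * 𝓕 ψ ξ = 𝓕 ψ ξ) ∧
      -- `J u` is the sum over `n ≥ 0` of the dyadic bumps `u n * 2^(n(s - d/p)) * ψ(2^(-n) x)`
      (∀ (u : EllInfty) (n : ℕ) (g : 𝓢(EuclideanSpace ℝ (Fin d), ℂ)),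
        HomBesov.block χ s p (-(n : ℤ)) (J u) g =
          ∫ x, g x * (u n * (((2 : ℝ) ^ ((n : ℝ) * (s - (d : ℝ) * (p⁻¹).toReal)) : ℝ) : ℂ) *
            ψ ((2 : ℝ) ^ (-(n : ℤ)) • x))) ∧
      (∀ (u : EllInfty) (m : ℤ), 0 < m → HomBesov.block χ s p m (J u) = 0) ∧
      -- `J` is an embedding
      (∃ a b : ℝ, 0 < a ∧ 0 < b ∧ ∀ u : EllInfty, a * ‖u‖ ≤ ‖J u‖ ∧ ‖J u‖ ≤ b * ‖u‖) ∧
      -- the induced map between the quotients is a quasi-isometric embedding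
      (∃ a b : ℝ, 0 < a ∧ 0 < b ∧ ∀ v : EllInfty ⧸ cZero,
        a * ‖v‖ ≤ ‖Submodule.mapQ cZero (closureHom χ s p) J.toLinearMap hJ v‖ ∧
        ‖Submodule.mapQ cZero (closureHom χ s p) J.toLinearMap hJ v‖ ≤ b * ‖v‖) := by
  obtain ⟨ψ, hψ, hpos, hψ0⟩ := χ.exists_isAnnular hd
  have hne : ψ ≠ 0 := by
    rintro rfl
    exact hψ0 rfl
  have hp0 : p ≠ 0 := (zero_lt_one.trans_le (Fact.out : 1 ≤ p)).ne'
  have hA : 0 < (eLpNorm ψ p volume).toReal :=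
    ENNReal.toReal_pos (SchwartzMap.eLpNorm_ne_zero hne hp0) (ψ.eLpNorm_lt_top p volume).ne
  obtain ⟨J, hJneg, hJpos, hJfin, hJn⟩ := hψ.exists_embedding (s := s) (p := p)
  obtain ⟨C, hC, hlow⟩ := hψ.exists_coeff_le hs hψ0
  have hJ : cZero ≤ (closureHom χ s p).comap J.toLinearMap := by
    intro u hu
    have hcl : IsClosed (closureHom χ s p : Set (HomBesov χ s p)) :=
      Submodule.isClosed_topologicalClosure _
    -- Truncations of a null sequence converge to it in norm, and `C^s_p` is closed.
    have ht : Tendsto (fun K => u.truncate K) atTop (𝓝 u) := by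
      refine Metric.tendsto_atTop.2 fun ε hε => ?_
      have hu' : Tendsto (fun n => ‖u n‖) atTop (𝓝 0) := by
        simpa using Tendsto.norm (show Tendsto (fun n => u n) atTop (𝓝 0) from hu)
      obtain ⟨N, hN⟩ := eventually_atTop.1 (hu'.eventually (gt_mem_nhds (half_pos hε)))
      refine ⟨N, fun K hK => ?_⟩
      rw [dist_comm, dist_eq_norm]
      refine (u.norm_sub_truncate_le (half_pos hε).le fun n hn => ?_).trans_lt (half_lt_self hε)
      exact (hN n (hK.trans hn)).le
    refine hcl.mem_of_tendsto ((J.continuous.tendsto u).comp ht) (Eventually.of_forall fun K => ?_)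
    exact hJfin _ K fun n hn => by rw [EllInfty.truncate_apply, if_neg (not_lt.2 hn)]
  have hup : ∀ v : EllInfty ⧸ cZero,
      ‖Submodule.mapQ cZero (closureHom χ s p) J.toLinearMap hJ v‖ ≤
        (eLpNorm ψ p volume).toReal * ‖v‖ :=
    Submodule.norm_mapQ_mk_le J.toLinearMap hJ hA.le fun u => (hJn u).le
  have hlo : ∀ v : EllInfty ⧸ cZero,
      C⁻¹ * ‖v‖ ≤ ‖Submodule.mapQ cZero (closureHom χ s p) J.toLinearMap hJ v‖ := by
    intro v
    obtain ⟨u, rfl⟩ := Submodule.Quotient.mk_surjective _ v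
    rw [inv_mul_le_iff₀ hC]
    refine le_of_forall_pos_le_add fun ε hε => ?_
    obtain ⟨f, hf, hfn⟩ := Submodule.Quotient.norm_mk_lt
      (Submodule.mapQ cZero (closureHom χ s p) J.toLinearMap hJ (Submodule.Quotient.mk u))
      (ε := ε / (2 * C)) (by positivity)
    rw [Submodule.mapQ_apply] at hf
    -- A near-optimal lift `f` of the image differs from `J u` by an element of `C^s_p`; with this
    -- element as `z`, the coefficient bound has `‖f‖` on the right.
    have hz : J u - f ∈ closureHom χ s p := by
      rw [← Submodule.neg_mem_iff, neg_sub]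
      exact (Submodule.Quotient.eq _).1 hf
    have h1 := hlow (J u) (J u - f) u (hJneg u) hz (ε / 2) (half_pos hε)
    rw [sub_sub_cancel] at h1
    refine (u.norm_mk_le_of_eventually_le (by positivity) h1).trans ?_
    calc C * ‖f‖ + ε / 2 ≤ C * (‖Submodule.mapQ cZero (closureHom χ s p) J.toLinearMap hJ
          (Submodule.Quotient.mk u)‖ + ε / (2 * C)) + ε / 2 := by gcongr
      _ = _ := by
        field_simp
        ring
  refine ⟨?_, ?_, ψ, J, hJ, ⟨hne, hpos, fun ξ => ?_⟩, fun u n g => ?_, hJpos,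
    ⟨_, _, hA, hA, fun u => ⟨(hJn u).ge, (hJn u).le⟩⟩,
    ⟨_, _, inv_pos.2 hC, hA, fun v => ⟨hlo v, hup v⟩⟩⟩
  · refine not_separableSpace_of_separated (fun x =>
      Submodule.mapQ cZero (closureHom χ s p) J.toLinearMap hJ
        (Submodule.Quotient.mk (EllInfty.ofBinary x))) (inv_pos.2 hC) fun x y hxy => ?_
    rw [dist_eq_norm, ← map_sub]
    refine le_trans ?_ (hlo _)
    exact le_mul_of_one_le_right (inv_pos.2 hC).le (EllInfty.one_le_norm_mk_ofBinary_sub hxy)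
  · refine not_separableSpace_of_separated (fun x =>
      (Submodule.Quotient.mk (EllInfty.ofBinary x) : EllInfty ⧸ cZero)) one_pos fun x y hxy => ?_
    rw [dist_eq_norm]
    exact EllInfty.one_le_norm_mk_ofBinary_sub hxy
  · simpa using hψ.annulus_mul 0 ξ
  · rw [hJneg]
    change _ * SchwartzMap.toTemperedDistributionCLM _ ℂ volume _ g = _
    rw [SchwartzMap.toTemperedDistributionCLM_apply_apply volume, ← integral_const_mul]
    refine integral_congr_ae (Eventually.of_forall fun x => ?_)
    simp only [SchwartzMap.dyadicDilate_apply, smul_eq_mul]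
    ring
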